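/- Let $X$ be a geometrically connected smooth projective curve over the finite field $\mathbb F_q$ with function field $K$, let $\infty$ be a place of $K$ of degree one with normalized additive valuation $v_\infty$, and put $\deg=-v_\infty$. Let $A\subset K$ be the ring of functions regular outside $\infty$, $K_\infty$ the completion of $K$ at $\infty$, and $\mathbb C_\infty$ the completion of an algebraic closure of $K_\infty$, with its absolute value $|\cdot|$. Fix a uniformizer $\pi$ of $K_\infty$, so that $K_\infty=\mathbb F_q((\pi))$; the sign of a nonzero element of $K_\infty$ is its leading coefficient as a Laurent series in $\pi$. For $d\ge 0$ let $A_{+,d}$ be the set of $a\in A$ of degree $d$ and sign $1$; it is finite. For $d\ge0$ and positive integers $n,s_1,\dots,s_r$ set $$S_d(n)=\sum_{a\in A_{+,d}}\frac1{a^n},\qquad S_d(s_1,\dots,s_r)=S_d(s_1)\,S_{<d}(s_2,\dots,s_r),\qquad S_{<d}(s_1,\dots,s_r)=\sum_{i=0}^{d-1}S_i(s_1,\dots,s_r),$$ with $S_{<d}(\emptyset)=1$, and $\zeta_A(s_1,\dots,s_r)=\lim_{d\to\infty}S_{<d}(s_1,\dots,s_r)\in K_\infty$ when this limit exists. Let $\mathbb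 T$ be the completion of $A\otimes_{\mathbb F_q}\mathbb C_\infty$ for the Gauss norm $\|\sum_i\beta_i\otimes f_i\|=\max_i|f_i|$, where $(\beta_i)$ is any $\mathbb F_q$-basis of $A$. Write $\chi(a)=a\otimes1$, and let $f\mapsto f^{(1)}$ be the continuous ring endomorphism of $\mathbb T$ which is the identity on $A\otimes 1$ and $c\mapsto c^q$ on $1\otimes\mathbb C_\infty$. An element $f\in\mathbb T$ is an entire function on $\operatorname{Spec}(A)^{an}_{\mathbb C_\infty}$ if $f=\sum_{i\ge0}\beta_if_i$ for an $\mathbb F_q$-basis $(\beta_i)_{i\ge0}$ of $A$ of strictly increasing degrees and coefficients $f_i\in\mathbb C_\infty$ such that $|f_i|\rho^{\deg\beta_i}\to0$ for all real $\rho>1$. Set $$\mathcal S_d=\sum_{a\in A_{+,d}}\frac{\chi(a)}{a}\in A\otimes_{\mathbb F_q}K,\qquad Z_k=\sum_{d\ge0}\mathcal S_d\,S_{<d}\bigl(q-1,(q-1)q,\dots,(q-1)q^{k-1}\bigr)\qquad(k\ge0).$$ Then for every $k\ge 0$ the limit $\zeta_A(q-1,(q-1)q,\dots,(q-1)q^{k-1})$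 exists in $K_\infty$, the series $Z_k$ converges in $\mathbb T$, and $Z_k$ and $Z_k^{(1)}$ are entire functions; and for every $k\ge1$ the following identity of entire functions holds: $$Z_0\cdot\zeta_A\bigl(q-1,(q-1)q,\dots,(q-1)q^{k-1}\bigr)=Z_k+Z_{k-1}^{(1)}.$$ -/

import Mathlib

open Filter Topology TensorProduct WithZero
open scoped RatFunc NNReal

noncomputable section

set_option linter.unusedSectionVars false

namespace HarmonicMZV

/-! ### The Tate algebra over a ring `A` of functions -/

section Tate

variable (F A C : Type*) [Field F] [Fintype F] [CommRing A] [Algebra F A]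
  [NormedField C] [IsUltrametricDist C] [Algebra F C]

/-- The algebraic tensor product of `A` and `C` over the finite field `F`, to be endowed with the
Gauss norm. The factor `C` is written on the left. -/
def PreTate : Type _ := C ⊗[F] A

instance : CommRing (PreTate F A C) := inferInstanceAs (CommRing (C ⊗[F] A))
instance : Algebra F (PreTate F A C) := inferInstanceAs (Algebra F (C ⊗[F] A))
instance : Algebra C (PreTate F A C) := inferInstanceAs (Algebra C (C ⊗[F] A))

variable {F A C}

/-- The pure tensor of `a : A` and `c : C`. -/
def PreTate.tmul (a : A) (c : C) : PreTate F A C := (c ⊗ₜ[F] a : C ⊗[F] A)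

variable (F A C) in
/-- A `C`-basis of the tensor product coming from an `F`-basis of `A`. -/
def PreTate.basis : Module.Basis (Module.Basis.ofVectorSpaceIndex F A) C (PreTate F A C) :=
  Algebra.TensorProduct.basis C (Module.Basis.ofVectorSpace F A)

/-- The Gauss norm: the largest absolute value of a coordinate in a basis of `A` over `F`
(the result is the same for every such basis). -/
def PreTate.gaussNorm (f : PreTate F A C) : ℝ≥0 :=
  ((PreTate.basis F A C).repr f).support.sup fun i => ‖(PreTate.basis F A C).repr f i‖₊

theorem nnnorm_algebraMap_le_one (c : F) : ‖algebraMap F C c‖₊ ≤ 1 := by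
  by_cases hc : c = 0
  · simp [hc]
  · have h : (algebraMap F C c) ^ (Fintype.card F - 1) = 1 := by
      rw [← map_pow, FiniteField.pow_card_sub_one_eq_one c hc, map_one]
    have h2 : ‖algebraMap F C c‖₊ ^ (Fintype.card F - 1) = 1 := by
      rw [← nnnorm_pow, h, nnnorm_one]
    have h3 : Fintype.card F - 1 ≠ 0 := by
      have := Fintype.one_lt_card (α := F); omega
    exact ((pow_eq_one_iff_of_nonneg zero_le h3).mp h2).le

namespace PreTate

theorem nnnorm_repr_le (f : PreTate F A C) (i) : ‖(basis F A C).repr f i‖₊ ≤ gaussNorm f := by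
  by_cases h : (basis F A C).repr f i = 0
  · simp [h]
  · exact Finset.le_sup (f := fun i => ‖(basis F A C).repr f i‖₊) (Finsupp.mem_support_iff.mpr h)

theorem gaussNorm_le_iff {f : PreTate F A C} {r : ℝ≥0} :
    gaussNorm f ≤ r ↔ ∀ i, ‖(basis F A C).repr f i‖₊ ≤ r :=
  ⟨fun h i => (nnnorm_repr_le f i).trans h, fun h => Finset.sup_le fun i _ => h i⟩

theorem gaussNorm_zero : gaussNorm (0 : PreTate F A C) = 0 := by
  simp [gaussNorm]

theorem gaussNorm_neg (f : PreTate F A C) : gaussNorm (-f) = gaussNorm f := by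
  simp [gaussNorm]

theorem gaussNorm_add (f g : PreTate F A C) :
    gaussNorm (f + g) ≤ max (gaussNorm f) (gaussNorm g) := by
  refine gaussNorm_le_iff.mpr fun i => ?_
  rw [map_add, Finsupp.add_apply]
  exact (IsUltrametricDist.nnnorm_add_le_max _ _).trans (max_le_max (nnnorm_repr_le f i) (nnnorm_repr_le g i))

theorem gaussNorm_sum {ι : Type*} (s : Finset ι) (f : ι → PreTate F A C) (r : ℝ≥0)
    (h : ∀ i ∈ s, gaussNorm (f i) ≤ r) : gaussNorm (∑ i ∈ s, f i) ≤ r := by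
  classical
  induction s using Finset.induction_on with
  | empty => simp [gaussNorm_zero]
  | insert a s ha ih =>
    rw [Finset.sum_insert ha]
    exact (gaussNorm_add _ _).trans (max_le (h a (by simp)) (ih fun i hi => h i (by simp [hi])))

theorem gaussNorm_tmul_le (a : A) (c : C) : gaussNorm (tmul (F := F) a c) ≤ ‖c‖₊ := by
  refine gaussNorm_le_iff.mpr fun i => ?_
  have : (basis F A C).repr (tmul a c) i =
      algebraMap F C ((Module.Basis.ofVectorSpace F A).repr a i) * c := by
    simp only [basis, tmul]
    erw [Algebra.TensorProduct.basis_repr_tmul]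
    simp [mul_comm]
  rw [this, nnnorm_mul]
  exact mul_le_of_le_one_left zero_le (nnnorm_algebraMap_le_one _)

theorem eq_sum (f : PreTate F A C) : f = ∑ i ∈ ((basis F A C).repr f).support,
    tmul (Module.Basis.ofVectorSpace F A i) ((basis F A C).repr f i) := by
  conv_lhs => rw [← (basis F A C).linearCombination_repr f]
  rw [Finsupp.linearCombination_apply, Finsupp.sum]
  refine Finset.sum_congr rfl fun i _ => ?_
  simp only [basis, tmul]
  erw [Algebra.TensorProduct.basis_apply, TensorProduct.smul_tmul']
  simp
  rfl

theorem tmul_mul_tmul (a b : A) (c d : C) :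
    tmul (F := F) a c * tmul b d = tmul (a * b) (c * d) :=
  Algebra.TensorProduct.tmul_mul_tmul c d a b

theorem gaussNorm_mul (f g : PreTate F A C) : gaussNorm (f * g) ≤ gaussNorm f * gaussNorm g := by
  conv_lhs => rw [eq_sum f, eq_sum g, Finset.sum_mul_sum]
  refine gaussNorm_sum _ _ _ fun i _ => gaussNorm_sum _ _ _ fun j _ => ?_
  rw [tmul_mul_tmul]
  refine (gaussNorm_tmul_le _ _).trans ?_
  rw [nnnorm_mul]
  exact mul_le_mul' (nnnorm_repr_le f i) (nnnorm_repr_le g j)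

theorem eq_zero_of_gaussNorm (f : PreTate F A C) (h : gaussNorm f = 0) : f = 0 := by
  refine (basis F A C).repr.map_eq_zero_iff.mp (Finsupp.ext fun i => ?_)
  have := nnnorm_repr_le f i
  rw [h] at this
  simpa using this

variable (F A C) in
/-- The Gauss norm as a ring norm. -/
def ringNorm : RingNorm (PreTate F A C) where
  toFun f := gaussNorm f
  map_zero' := by simp [gaussNorm_zero]
  add_le' f g := by
    have h := (gaussNorm_add f g).trans (max_le_add_of_nonneg zero_le zero_le)
    exact_mod_cast h
  neg' f := by rw [gaussNorm_neg]
  mul_le' f g := by exact_mod_cast gaussNorm_mul f g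
  eq_zero_of_map_eq_zero' f h := eq_zero_of_gaussNorm f (by exact_mod_cast h)

instance : NormedCommRing (PreTate F A C) where
  __ := (ringNorm F A C).toNormedRing
  mul_comm := mul_comm

theorem norm_def (f : PreTate F A C) : ‖f‖ = gaussNorm f := rfl

variable (F A C) in
/-- The twist of the tensor product: the identity on `A` and `c ↦ c ^ q` on `C`. -/
def twist : PreTate F A C →+* PreTate F A C :=
  (Algebra.TensorProduct.map (FiniteField.frobeniusAlgHom F C) (AlgHom.id F A)).toRingHom

theorem twist_tmul (a : A) (c : C) :
    twist F A C (tmul a c) = tmul a (c ^ Fintype.card F) := rfl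

theorem gaussNorm_twist_le (f : PreTate F A C) :
    gaussNorm (twist F A C f) ≤ gaussNorm f ^ Fintype.card F := by
  conv_lhs => rw [eq_sum f, map_sum]
  refine gaussNorm_sum _ _ _ fun i _ => ?_
  rw [twist_tmul]
  refine (gaussNorm_tmul_le _ _).trans ?_
  rw [nnnorm_pow]
  exact pow_le_pow_left' (nnnorm_repr_le f i) _

theorem continuous_twist : Continuous (twist F A C) := by
  refine continuous_of_continuousAt_zero (twist F A C).toAddMonoidHom ?_
  have h0 : (twist F A C).toAddMonoidHom 0 = 0 := map_zero _
  rw [ContinuousAt, h0]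
  refine squeeze_zero_norm (a := fun f => ‖f‖ ^ Fintype.card F) (fun f => ?_) ?_
  · exact_mod_cast gaussNorm_twist_le f
  · have : Continuous fun f : PreTate F A C => ‖f‖ ^ Fintype.card F := by fun_prop
    simpa [zero_pow Fintype.card_ne_zero] using this.tendsto 0

end PreTate

variable (F A C) in
/-- The Tate algebra: the completion of the tensor product of `A` and `C` over `F` for the Gauss
norm. -/
abbrev Tate : Type _ := UniformSpace.Completion (PreTate F A C)

/-- The image in the Tate algebra of the pure tensor of `a : A` and `c : C`. -/
def Tate.tmul (a : A) (c : C) : Tate F A C := (PreTate.tmul (F := F) a c : PreTate F A C)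

variable (F A) in
/-- The constant of the Tate algebra attached to `c : C`. -/
def Tate.const (c : C) : Tate F A C := Tate.tmul 1 c

variable (F C) in
/-- The tautological function `χ(a)`. -/
def Tate.chi (a : A) : Tate F A C := Tate.tmul a 1

variable (F A C) in
/-- The twist `f ↦ f⁽¹⁾`: the continuous extension to the Tate algebra of the map which is the
identity on `A` and `c ↦ c ^ q` on `C`, where `q` is the cardinality of `F`. -/
def Tate.twist : Tate F A C →+* Tate F A C :=
  UniformSpace.Completion.mapRingHom (PreTate.twist F A C) PreTate.continuous_twist

end Tate

/-! ### Places of function fields -/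

/-- A place of a field `K` over a field `F` of constants, given by its normalized valuation,
written multiplicatively. -/
structure Place (F K : Type*) [Field F] [Field K] [Algebra F K] where
  val : Valuation K ℤᵐ⁰
  surjective : Function.Surjective val
  trivial_on_constants : ∀ c : F, c ≠ 0 → val (algebraMap F K c) = 1

namespace Place

variable {F K : Type*} [Field F] [Field K] [Algebra F K] (P : Place F K)

/-- The place has degree one: its residue field is the field of constants `F`. -/
def IsRational : Prop := ∀ x : K, P.val x ≤ 1 → ∃ c : F, P.val (x - algebraMap F K c) < 1

/-- The degree of a nonzero element: minus its normalized additive valuation at the place. -/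
def deg (x : K) : ℤ := WithZero.log (P.val x)

/-- The ring of elements of `K` that are regular outside the place: those lying in every valuation
ring of `K` over `F` other than the valuation ring of the place. (The improper valuation ring `K`
imposes no condition.) -/
def baseRing : Subalgebra F K where
  carrier := {x | ∀ O : ValuationSubring K, (∀ c : F, algebraMap F K c ∈ O) →
    O ≠ P.val.valuationSubring → x ∈ O}
  mul_mem' hx hy O h h' := O.mul_mem _ _ (hx O h h') (hy O h h')
  add_mem' hx hy O h h' := O.add_mem _ _ (hx O h h') (hy O h h')
  algebraMap_mem' c _ h _ := h c

variable [Fintype F]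

/-- The cardinality of the finite field `F` in `ℝ≥0`. -/
def q (_P : Place F K) : ℝ≥0 := Fintype.card F

theorem one_lt_q : 1 < P.q := by
  have := Fintype.one_lt_card (α := F)
  rw [q]
  exact_mod_cast this

/-- The absolute value `x ↦ q ^ deg x` of the place. -/
def absVal : AbsoluteValue K ℝ where
  toFun x := WithZeroMulInt.toNNReal P.one_lt_q.ne_zero (P.val x)
  map_mul' x y := by simp
  nonneg' x := NNReal.coe_nonneg _
  eq_zero' x := by simp
  add_le' x y := by
    have hm := (WithZeroMulInt.toNNReal_strictMono P.one_lt_q).monotone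
    have h := (hm (P.val.map_add x y)).trans_eq hm.map_max
    exact_mod_cast h.trans (max_le_add_of_nonneg zero_le zero_le)

theorem absVal_add_le_max (x y : K) : P.absVal (x + y) ≤ max (P.absVal x) (P.absVal y) := by
  have hm := (WithZeroMulInt.toNNReal_strictMono P.one_lt_q).monotone
  have h := (hm (P.val.map_add x y)).trans_eq hm.map_max
  exact_mod_cast h

/-- The completion `K_∞` of `K` at the place. -/
def KInf : Type _ := P.absVal.Completion

instance : NormedField P.KInf := inferInstanceAs (NormedField P.absVal.Completion)
instance : CompleteSpace P.KInf := inferInstanceAs (CompleteSpace P.absVal.Completion)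

/-- The embedding of `K` into its completion. -/
def toKInf : K →+* P.KInf :=
  (UniformSpace.Completion.coeRingHom (α := WithAbs P.absVal)).comp
    (WithAbs.equiv P.absVal).symm.toRingHom

instance : Algebra K P.KInf := P.toKInf.toAlgebra

theorem norm_toKInf (x : K) : ‖algebraMap K P.KInf x‖ = P.absVal x :=
  UniformSpace.Completion.norm_coe (E := WithAbs P.absVal) _

theorem denseRange_toKInf : DenseRange (algebraMap K P.KInf) :=
  (UniformSpace.Completion.denseRange_coe (α := WithAbs P.absVal)).comp
    (WithAbs.equiv P.absVal).symm.surjective.denseRange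
    (UniformSpace.Completion.continuous_coe _)

instance : IsUltrametricDist P.KInf := by
  refine IsUltrametricDist.isUltrametricDist_of_forall_norm_add_le_max_norm fun x y => ?_
  refine DenseRange.induction_on₂ P.denseRange_toKInf
    (p := fun x y => ‖x + y‖ ≤ max ‖x‖ ‖y‖) ?_ (fun a b => ?_) x y
  · exact isClosed_le (by fun_prop) (by fun_prop)
  · rw [← map_add, norm_toKInf, norm_toKInf, norm_toKInf]
    exact P.absVal_add_le_max a b

instance : NontriviallyNormedField P.KInf where
  non_trivial := by
    obtain ⟨x, hx⟩ := P.surjective (WithZero.exp 1)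
    refine ⟨algebraMap K P.KInf x, ?_⟩
    rw [norm_toKInf]
    have h : (1 : ℤᵐ⁰) < P.val x := by
      rw [hx, ← WithZero.exp_zero, WithZero.exp_lt_exp]; norm_num
    have h2 := WithZeroMulInt.toNNReal_strictMono P.one_lt_q h
    rw [map_one] at h2
    exact_mod_cast h2

/-- An algebraic closure of `K_∞`. -/
abbrev KInfBar : Type _ := AlgebraicClosure P.KInf

/-- The absolute value of `K_∞` extends uniquely to its algebraic closure. -/
instance : NormedField P.KInfBar := spectralNorm.normedField P.KInf P.KInfBar

instance : IsUltrametricDist P.KInfBar :=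
  IsUltrametricDist.isUltrametricDist_of_forall_norm_add_le_max_norm
    (isNonarchimedean_spectralNorm (K := P.KInf) (L := P.KInfBar))

/-- The field `ℂ_∞`: the completion of an algebraic closure of `K_∞`. -/
def CInf : Type _ := UniformSpace.Completion P.KInfBar

instance : NormedField P.CInf := inferInstanceAs (NormedField (UniformSpace.Completion P.KInfBar))
instance : CompleteSpace P.CInf :=
  inferInstanceAs (CompleteSpace (UniformSpace.Completion P.KInfBar))

instance : IsUltrametricDist P.CInf := by
  refine IsUltrametricDist.isUltrametricDist_of_forall_norm_add_le_max_norm fun x y => ?_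
  refine UniformSpace.Completion.induction_on₂ (α := P.KInfBar) (β := P.KInfBar)
    (p := fun x y => (‖(x + y : P.CInf)‖ : ℝ) ≤ max (‖(x : P.CInf)‖) (‖(y : P.CInf)‖)) x y
    ?_ (fun a b => ?_)
  · exact isClosed_le (continuous_norm.comp (continuous_add (M := P.CInf)))
      ((continuous_norm.comp continuous_fst).max (continuous_norm.comp continuous_snd))
  · have h1 : ((a : UniformSpace.Completion P.KInfBar) + b : UniformSpace.Completion P.KInfBar)
      = ((a + b : P.KInfBar) : UniformSpace.Completion P.KInfBar) :=
      (UniformSpace.Completion.coe_add a b).symm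
    have h2 : ∀ z : P.KInfBar, ‖((z : UniformSpace.Completion P.KInfBar) : P.CInf)‖ = ‖z‖ :=
      fun z => UniformSpace.Completion.norm_coe z
    have h3 := IsUltrametricDist.norm_add_le_max a b
    rw [← h2, ← h2, ← h2, ← h1] at h3
    exact h3

/-- The embedding of `K_∞` into `ℂ_∞`. -/
def toCInf : P.KInf →+* P.CInf :=
  (UniformSpace.Completion.coeRingHom (α := P.KInfBar)).comp (algebraMap P.KInf P.KInfBar)

instance : Algebra P.KInf P.CInf := P.toCInf.toAlgebra
instance : Algebra K P.CInf := (P.toCInf.comp P.toKInf).toAlgebra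
instance : Algebra F P.CInf := ((P.toCInf.comp P.toKInf).comp (algebraMap F K)).toAlgebra

/-- `π` is a uniformizer of `K_∞`. -/
def IsUniformizer (π : P.KInf) : Prop := ‖π‖ = (P.q : ℝ)⁻¹

variable {P}

open Classical in
/-- The sign function attached to the uniformizer `π`, that is, the leading coefficient of a nonzero
element of `K_∞ = F((π))`; the sign of `0` is set to `0`. It is multiplicative on `K_∞ˣ`, the
identity on `Fˣ`, trivial on one-units, and maps `π` to `1`. -/
def sgn (π x : P.KInf) : F :=
  if h : ∃ c : F, c ≠ 0 ∧
      ∃ n : ℤ, ‖x * π ^ (-n) - algebraMap K P.KInf (algebraMap F K c)‖ < 1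
  then h.choose else 0

/-- The set `A_{+,d}` of monic elements of degree `d` of the base ring `A`. -/
def monic (π : P.KInf) (d : ℕ) : Set P.baseRing :=
  {a | sgn π (algebraMap K P.KInf (a : K)) = 1 ∧ P.deg (a : K) = d}

/-! ### Power sums and multiple zeta values -/

/-- The power sum `S_d(n)` in `K`. -/
def powerSum (π : P.KInf) (d n : ℕ) : K := ∑ᶠ a ∈ monic π d, 1 / (a : K) ^ n

/-- The sum `S_{<d}(s₁, …, s_r)` in `K`, where `S_d(s₁, …, s_r) = S_d(s₁) S_{<d}(s₂, …, s_r)`. It is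
`1` for the empty tuple. -/
def multiSum (π : P.KInf) : List ℕ → ℕ → K
  | [], _ => 1
  | s :: l, d => ∑ i ∈ Finset.range d, powerSum π i s * multiSum π l i

/-- The multiple zeta value `ζ_A(s₁, …, s_r)` in `K_∞`. -/
def zeta (π : P.KInf) (s : List ℕ) : P.KInf :=
  limUnder atTop fun d => algebraMap K P.KInf (multiSum π s d)

variable (F) in
/-- The tuple `(q - 1, (q - 1) q, …, (q - 1) q ^ (k - 1))`. -/
def expTuple (k : ℕ) : List ℕ :=
  (List.range k).map fun j => (Fintype.card F - 1) * Fintype.card F ^ j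

/-! ### Entire functions and the functions `Z_k` -/

variable (P) in
/-- The Tate algebra over `ℂ_∞` attached to the base ring. -/
abbrev TateInf : Type _ := Tate F P.baseRing P.CInf

/-- An element of the Tate algebra is an entire function if it is a series `∑ βᵢ fᵢ`, for an
`F`-basis `βᵢ` of `A` of strictly increasing degrees and coefficients `fᵢ` in `ℂ_∞` such that
`|fᵢ| ρ ^ deg βᵢ` tends to zero for all real `ρ > 1`. -/
def IsEntire (f : P.TateInf) : Prop :=
  ∃ (β : Module.Basis ℕ F P.baseRing) (c : ℕ → P.CInf),
    StrictMono (fun i => P.deg (β i : K)) ∧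
    (∀ ρ : ℝ, 1 < ρ → Tendsto (fun i => ‖c i‖ * ρ ^ P.deg (β i : K)) atTop (𝓝 0)) ∧
    HasSum (fun i => Tate.tmul (β i) (c i)) f

/-- The function `𝒮_d`, the sum of `χ(a) / a` over the monic elements `a` of degree `d`. -/
def tateSum (π : P.KInf) (d : ℕ) : P.TateInf :=
  ∑ᶠ a ∈ monic π d,
    Tate.chi F P.CInf a * Tate.const F P.baseRing (algebraMap K P.CInf (1 / (a : K)))

/-- The `d`-th term `𝒮_d S_{<d}(q - 1, …, (q - 1) q ^ (k - 1))` of the series `Z_k`. -/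
def ZTerm (π : P.KInf) (k d : ℕ) : P.TateInf :=
  tateSum π d *
    Tate.const F P.baseRing (algebraMap K P.CInf (multiSum π (expTuple F k) d))

/-- The function `Z_k`, the sum of its terms in the Tate algebra. -/
def Z (π : P.KInf) (k : ℕ) : P.TateInf := ∑' d, ZTerm π k d

end Place

end HarmonicMZV

end

namespace HarmonicMZV

/-! ### Power sums over finite vector spaces -/

section PowerSums

open Polynomial

variable {F L U : Type*} [Field F] [Fintype F] [Field L] [Algebra F L]
  [AddCommGroup U] [Module F U] [Fintype U]

/-! Everything rests on one identity for the finite sums, `𝒮_d⁽¹⁾ = (𝒮_0 + ⋯ + 𝒮_d) · S_d(q - 1)`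
(`twist_tateSum`). Let `U` be the space of elements of `A` of degree at most `d` and `V` that of
elements of degree less than `d`; the monic elements of degree `d`, if any, form a coset `a + V`.
Since `χ(u)/u` does not change when `u` is scaled by `Fˣ`, and `q - 1 = -1` in `F`, the sum `𝒮_0 + ⋯
+ 𝒮_d` equals `-∑ χ(u)/u` over the nonzero `u` in `U`. Reading off coordinates of `χ` in a basis of
`U`, the identity becomes a statement about an arbitrary `F`-linear map `φ : U → K` in place of `χ`,
and it is linear in `φ`. Such maps are combinations of the powers `u ↦ u ^ q ^ i` with `i < dim U`.
For `i = 0` both sides are `S_d(q - 1)`; for `i > 0` both sides vanish, because power sums of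
exponent `q ^ j - 1` over affine spaces of dimension greater than `j` vanish (`sum_div_pow_card`).

Given this, `(∑_{d<D} 𝒮_d) · S_{<D}(q - 1, …)` is the sum of the `D`-th partial sums of `Z_k` and of
`Z_{k-1}⁽¹⁾`, by induction on `D` (`partial_sum_identity`), and the theorem is the limit `D → ∞`.

Convergence and entireness come from the size of the coefficients of `𝒮_d` in a basis of `A`. Such a
coefficient is a combination of sums of `1/a` over cosets of a subspace of codimension at most one
in `V`. The logarithmic derivative of an additive polynomial turns each of these sums into a product
with one small factor for each nonzero vector of the subspace, so the coefficients decay doubly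
exponentially in `d` (`exists_absVal_coeffSum_le`).

This needs `dim V` to grow linearly with `d`, hence a nonconstant element of `A`. As `A` is
described by valuation rings only, its existence is a weak form of Riemann's theorem, proved by a
pigeonhole count over the finite field (`exists_single_pole`). -/

/-- A polynomial of degree less than `|U|` that is constant on an embedded copy of `U` is
constant. -/
theorem eval_eq_of_constant_on {f : U → L} (hf : Function.Injective f) (p : L[X]) (c : L)
    (hdeg : p.natDegree < Fintype.card U) (hp : ∀ u, p.eval (f u) = c) (z : L) :
    p.eval z = c := by
  have h : p - C c = 0 := by
    refine Polynomial.eq_zero_of_natDegree_lt_card_of_eval_eq_zero (p - C c) hf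
      (fun u => by simp [hp]) ?_
    rwa [natDegree_sub_C]
  rw [sub_eq_zero.mp h, eval_C]

theorem card_cast_eq_zero : ((Fintype.card F : ℕ) : L) = 0 := by
  rw [← map_natCast (algebraMap F L), FiniteField.cast_card_eq_zero, map_zero]

theorem one_lt_card_pow_iff {j m : ℕ} : Fintype.card F ^ j < Fintype.card F ^ m ↔ j < m :=
  Nat.pow_lt_pow_iff_right Fintype.one_lt_card

/-- One basis vector is split off. The sum over the span of the others is a polynomial in the base
point of degree less than the size of that span and invariant under it, hence constant; summing a
constant over the `q` multiples of the remaining vector gives zero. -/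
theorem sum_add_pow_eq_zero_of_linearIndependent {m : ℕ} (w : Fin m → L)
    (hw : LinearIndependent F w) (j : ℕ) (hj : j < m) (z : L) :
    ∑ x : Fin m → F, (z + ∑ i, x i • w i) ^ (Fintype.card F ^ j - 1) = 0 := by
  classical
  obtain ⟨m, rfl⟩ : ∃ m', m = m' + 1 := ⟨m - 1, by omega⟩
  set w' : Fin m → L := fun i => w i.succ with hw'
  have hi : LinearIndependent F w' := hw.comp _ (Fin.succ_injective m)
  set s : (Fin m → F) → L := fun x => ∑ i, x i • w' i with hs
  have hsadd : ∀ x y, s (x + y) = s x + s y := fun x y => by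
    simp [hs, add_smul, Finset.sum_add_distrib]
  have hsinj : Function.Injective s := hi.fintypeLinearCombination_injective
  set p : L[X] := ∑ x : Fin m → F, (X + C (s x)) ^ (Fintype.card F ^ j - 1) with hp
  have hpe : ∀ y, p.eval y = ∑ x, (y + s x) ^ (Fintype.card F ^ j - 1) := fun y => by
    simp [hp, eval_finsetSum]
  have hdeg : p.natDegree < Fintype.card (Fin m → F) := by
    have h1 : Fintype.card (Fin m → F) = Fintype.card F ^ m := by simp
    have h2 : Fintype.card F ^ j ≤ Fintype.card F ^ m :=
      Nat.pow_le_pow_right Fintype.card_pos (by omega)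
    have h3 : 0 < Fintype.card F ^ j := pow_pos Fintype.card_pos _
    have h4 : p.natDegree ≤ Fintype.card F ^ j - 1 := by
      refine natDegree_sum_le_of_forall_le _ _ fun x _ => ?_
      refine natDegree_pow_le.trans ?_
      rw [natDegree_X_add_C, mul_one]
    omega
  have hconst : ∀ y, p.eval y = p.eval 0 := by
    refine eval_eq_of_constant_on hsinj p _ hdeg fun u => ?_
    rw [hpe, hpe, ← Equiv.sum_comp (Equiv.addLeft u) (fun x => (0 + s x) ^ _)]
    simp [hsadd]
  calc ∑ x : Fin (m + 1) → F, (z + ∑ i, x i • w i) ^ (Fintype.card F ^ j - 1)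
      = ∑ c : F, p.eval (z + c • w 0) := by
        rw [← (Fin.consEquiv fun _ : Fin (m + 1) => F).sum_comp, Fintype.sum_prod_type]
        refine Finset.sum_congr rfl fun c _ => ?_
        rw [hpe]
        refine Finset.sum_congr rfl fun x _ => ?_
        simp [Fin.sum_univ_succ, hs, hw', add_assoc, Fin.consEquiv]
    _ = 0 := by
        simp [hconst, card_cast_eq_zero]

/-- The power sums of exponent `q ^ j - 1` over affine spaces of dimension larger than `j`
vanish. -/
theorem sum_add_pow_eq_zero (f : U →ₗ[F] L) (hf : Function.Injective f) (j : ℕ)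
    (hj : Fintype.card F ^ j < Fintype.card U) (z : L) :
    ∑ u : U, (z + f u) ^ (Fintype.card F ^ j - 1) = 0 := by
  have b := Module.finBasis F U
  rw [Module.card_eq_pow_finrank (K := F) (V := U), one_lt_card_pow_iff] at hj
  rw [← b.equivFun.symm.toEquiv.sum_comp]
  have hi : LinearIndependent F (fun i => f (b i)) :=
    b.linearIndependent.map' f (LinearMap.ker_eq_bot.mpr hf)
  rw [← sum_add_pow_eq_zero_of_linearIndependent _ hi j hj z]
  refine Finset.sum_congr rfl fun x _ => ?_
  simp [Module.Basis.equivFun_symm_apply]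

/-- The left side is the derivative at `z` of the additive polynomial `∏ (X - f v)`, which is
constant. Its degree is less than `|U|`, and its values on `f(U)` agree after the substitution `v ↦
u - v`. -/
theorem sum_prod_erase_sub [DecidableEq U] (f : U →+ L) (hf : Function.Injective f) (z : L) :
    ∑ u : U, ∏ v ∈ Finset.univ.erase u, (z - f v) = ∏ v ∈ Finset.univ.erase (0 : U), f v := by
  set p : L[X] := ∑ u : U, ∏ v ∈ Finset.univ.erase u, (X - C (f v)) with hp
  have hpe : ∀ y, p.eval y = ∑ u : U, ∏ v ∈ Finset.univ.erase u, (y - f v) := fun y => by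
    simp [hp, eval_finsetSum, eval_prod]
  rw [← hpe]
  refine eval_eq_of_constant_on hf p _ ?_ (fun u => ?_) z
  · have : 0 < Fintype.card U := Fintype.card_pos
    have h : p.natDegree ≤ Fintype.card U - 1 := by
      refine natDegree_sum_le_of_forall_le _ _ fun x _ => ?_
      refine (natDegree_prod_le _ _).trans ?_
      simp [Finset.card_erase_of_mem]
    omega
  · rw [hpe, Finset.sum_eq_single u]
    · refine Finset.prod_bij' (fun v _ => u - v) (fun v _ => u - v) ?_ ?_ ?_ ?_ ?_
      · intro a ha; simpa [sub_eq_zero, eq_comm] using ha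
      · intro a ha; simpa using ha
      · simp
      · simp
      · simp
    · intro v _ hv
      exact Finset.prod_eq_zero (i := u) (by simp [hv.symm]) (by simp)
    · simp

/-- The logarithmic derivative of `∏ (X - f v)`. It trades a sum for a product, whose size can be
estimated factor by factor. -/
theorem sum_inv_sub [DecidableEq U] (f : U →+ L) (hf : Function.Injective f) (z : L)
    (hz : ∀ u, z ≠ f u) :
    ∑ u : U, (z - f u)⁻¹ = z⁻¹ * ∏ v ∈ Finset.univ.erase (0 : U), (f v / (z - f v)) := by
  have hne : ∀ u, z - f u ≠ 0 := fun u => sub_ne_zero.mpr (hz u)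
  have h0 : ∏ v : U, (z - f v) ≠ 0 := Finset.prod_ne_zero_iff.mpr fun v _ => hne v
  have hz0 : z ≠ 0 := by simpa using hz 0
  have hmul : ∏ v : U, (z - f v) = z * ∏ v ∈ Finset.univ.erase (0 : U), (z - f v) := by
    rw [← Finset.mul_prod_erase _ _ (Finset.mem_univ (0 : U))]; simp
  rw [Finset.prod_div_distrib, ← sum_prod_erase_sub f hf z]
  have h1 : ∀ u : U, (z - f u)⁻¹ = (∏ v ∈ Finset.univ.erase u, (z - f v)) / ∏ v : U, (z - f v) := by
    intro u
    rw [← Finset.mul_prod_erase _ _ (Finset.mem_univ u)]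
    have : ∏ v ∈ Finset.univ.erase u, (z - f v) ≠ 0 := Finset.prod_ne_zero_iff.mpr fun v _ => hne v
    field_simp [hne u]
  rw [Finset.sum_congr rfl fun u _ => h1 u, ← Finset.sum_div, hmul, inv_mul_eq_div, div_div,
    mul_comm z]

/-- Every `F`-linear map on a finite space is a combination of powers of Frobenius. -/
theorem exists_eq_sum_pow (f : U →ₗ[F] L) (hf : Function.Injective f) (φ : U →ₗ[F] L) :
    ∃ l : Fin (Module.finrank F U) → L, ∀ u, φ u = ∑ i, l i * f u ^ Fintype.card F ^ (i : ℕ) := by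
  set m := Module.finrank F U with hm
  set ψ : Fin m → (U →ₗ[F] L) := fun i =>
    ((FiniteField.frobeniusAlgHom F L) ^ (i : ℕ)).toLinearMap ∘ₗ f with hψ
  have hψa : ∀ i u, ψ i u = f u ^ Fintype.card F ^ (i : ℕ) := fun i u => by
    simp only [hψ, LinearMap.comp_apply, AlgHom.toLinearMap_apply, AlgHom.coe_pow,
      FiniteField.coe_frobeniusAlgHom, pow_iterate]
  -- A relation between the Frobenius powers is a polynomial of degree at most `q ^ (m - 1)`
  -- vanishing on the `q ^ m` points of `f(U)`.
  have hli : LinearIndependent L ψ := by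
    rw [Fintype.linearIndependent_iff]
    intro g hg i
    set p : L[X] := ∑ i, C (g i) * X ^ Fintype.card F ^ (i : ℕ) with hp
    have hdeg : p.natDegree < Fintype.card U := by
      have hpos : 0 < m := i.pos
      rw [Module.card_eq_pow_finrank (K := F) (V := U)]
      refine lt_of_le_of_lt (b := Fintype.card F ^ (m - 1)) ?_ (one_lt_card_pow_iff.mpr (by omega))
      refine natDegree_sum_le_of_forall_le _ _ fun x _ => ?_
      refine (natDegree_C_mul_X_pow_le _ _).trans (Nat.pow_le_pow_right Fintype.card_pos (by omega))
    have h0 : p = 0 := by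
      refine Polynomial.eq_zero_of_natDegree_lt_card_of_eval_eq_zero p hf (fun u => ?_) hdeg
      have := LinearMap.congr_fun hg u
      simpa [hp, eval_finsetSum, hψa] using this
    have hc := congrArg (fun r => coeff r (Fintype.card F ^ (i : ℕ))) h0
    simp only [hp, finsetSum_coeff, coeff_C_mul, coeff_X_pow, coeff_zero] at hc
    rw [Finset.sum_eq_single i] at hc
    · simpa using hc
    · intro b _ hb
      rw [if_neg, mul_zero]
      intro h
      exact hb (Fin.ext (Nat.pow_right_injective Fintype.one_lt_card h.symm))
    · simp
  have htop := hli.span_eq_top_of_card_eq_finrank' (by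
    rw [Fintype.card_fin, hm, Module.finrank_linearMap_self])
  have : φ ∈ Submodule.span L (Set.range ψ) := htop ▸ Submodule.mem_top
  obtain ⟨l, hl⟩ := (Submodule.mem_span_range_iff_exists_fun L).mp this
  refine ⟨l, fun u => ?_⟩
  rw [← hl]
  simp [hψa]

/-- The algebraic core of the harmonic product. Both sides are linear in `φ`, so it suffices to
treat `φ = f ^ q ^ i` with `i < dim U`. -/
theorem sum_div_pow_card (f : U →ₗ[F] L) (hf : Function.Injective f) (V : Submodule F U)
    [Fintype V] (hV : Fintype.card U = Fintype.card F * Fintype.card V) (a : U) (ha : a ∉ V)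
    (φ : U →ₗ[F] L) :
    ∑ v : V, φ (a + v) / f (a + v) ^ Fintype.card F =
      (-∑ u : U, φ u / f u) * ∑ v : V, 1 / f (a + v) ^ (Fintype.card F - 1) := by
  classical
  have hq : 1 < Fintype.card F := Fintype.one_lt_card
  obtain ⟨l, hl⟩ := exists_eq_sum_pow f hf φ
  have hne : ∀ v : V, f (a + v) ≠ 0 := fun v h => by
    rw [map_eq_zero_iff f hf] at h
    exact ha ((Submodule.add_mem_iff_left V v.2).mp (h ▸ V.zero_mem))
  have key : ∀ i : Fin (Module.finrank F U),
      ∑ v : V, f (a + v) ^ Fintype.card F ^ (i : ℕ) / f (a + v) ^ Fintype.card F =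
      (-∑ u : U, f u ^ Fintype.card F ^ (i : ℕ) / f u) *
        ∑ v : V, 1 / f (a + v) ^ (Fintype.card F - 1) := by
    intro i
    have hcU := Module.card_eq_pow_finrank (K := F) (V := U)
    have hiU : Fintype.card F ^ (i : ℕ) < Fintype.card U := hcU ▸ one_lt_card_pow_iff.mpr i.2
    rcases Nat.eq_zero_or_pos (i : ℕ) with h0 | h0
    -- Here `i = 0`: the quotient is `1` except at `u = 0`, where `0 / 0 = 0`, so the sum is `|U| -
    -- 1 = -1`.
    · have h1 : ∑ u : U, f u ^ Fintype.card F ^ (i : ℕ) / f u = -1 := by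
        have h2 : ∀ u : U, f u ^ Fintype.card F ^ (i : ℕ) / f u = 1 - if u = 0 then 1 else 0 := by
          intro u
          by_cases hu : u = 0
          · simp [hu]
          · have : f u ≠ 0 := by rwa [Ne, map_eq_zero_iff f hf]
            simp [h0, hu, this]
        rw [Finset.sum_congr rfl fun u _ => h2 u, Finset.sum_sub_distrib]
        simp [hV, card_cast_eq_zero]
      rw [h1, neg_neg, one_mul]
      refine Finset.sum_congr rfl fun v _ => ?_
      rw [h0, pow_zero, pow_one, div_eq_div_iff (pow_ne_zero _ (hne v)) (pow_ne_zero _ (hne v)),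
        one_mul, mul_pow_sub_one (by omega)]
    · have h1 : ∑ u : U, f u ^ Fintype.card F ^ (i : ℕ) / f u = 0 := by
        rw [← sum_add_pow_eq_zero f hf i hiU 0]
        refine Finset.sum_congr rfl fun u _ => ?_
        have h2 : 1 < Fintype.card F ^ (i : ℕ) := Nat.one_lt_pow h0.ne' hq
        rw [zero_add]
        by_cases hu : f u = 0
        · rw [hu, zero_pow (by omega), zero_pow (by omega), zero_div]
        · rw [div_eq_iff hu, pow_sub_one_mul (by omega)]
      rw [h1, neg_zero, zero_mul]
      obtain ⟨j, hj⟩ : ∃ j, (i : ℕ) = j + 1 := ⟨i - 1, by omega⟩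
      have hjV : Fintype.card F ^ j < Fintype.card V := by
        rw [hj, pow_succ, hV, mul_comm] at hiU
        exact Nat.lt_of_mul_lt_mul_left hiU
      -- With `i = j + 1`, each term is the `q`-th power of `f(a + v) ^ (q ^ j - 1)`, and `j < dim
      -- V`; the vanishing over the coset is therefore carried over by Frobenius.
      have h3 := sum_add_pow_eq_zero (f ∘ₗ V.subtype)
        (hf.comp V.injective_subtype) j hjV (f a)
      have h4 := congrArg (FiniteField.frobeniusAlgHom F L) h3
      rw [map_sum, map_zero] at h4
      rw [← h4]
      refine Finset.sum_congr rfl fun v _ => ?_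
      simp only [FiniteField.coe_frobeniusAlgHom, LinearMap.comp_apply, Submodule.subtype_apply,
        ← map_add]
      rw [div_eq_iff (pow_ne_zero _ (hne v)), ← mul_pow, pow_sub_one_mul
        (pow_pos Fintype.card_pos _).ne', hj, pow_succ, pow_mul]
  have e1 : ∑ v : V, φ (a + v) / f (a + v) ^ Fintype.card F =
      ∑ i, l i * ∑ v : V, f (a + v) ^ Fintype.card F ^ (i : ℕ) / f (a + v) ^ Fintype.card F := by
    simp_rw [hl, Finset.sum_div, Finset.mul_sum]
    rw [Finset.sum_comm]
    simp_rw [mul_div_assoc]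
  have e2 : ∑ u : U, φ u / f u = ∑ i, l i * ∑ u : U, f u ^ Fintype.card F ^ (i : ℕ) / f u := by
    simp_rw [hl, Finset.sum_div, Finset.mul_sum]
    rw [Finset.sum_comm]
    simp_rw [mul_div_assoc]
  rw [e1, e2, ← Finset.sum_neg_distrib, Finset.sum_mul]
  refine Finset.sum_congr rfl fun i _ => ?_
  rw [key i]
  ring

/-- Over a coset of a finite additive group that is small compared to the coset, the sum of the
inverses is small. -/
theorem abv_sum_inv_add_le (abv : AbsoluteValue L ℝ) (f : U →+ L) (hf : Function.Injective f)
    (z : L) (κ : ℝ) (hz : ∀ u, 1 ≤ abv (z + f u))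
    (hle : ∀ u v, abv (f u) ≤ κ * abv (z + f v)) :
    abv (∑ u : U, (z + f u)⁻¹) ≤ κ ^ (Fintype.card U - 1) := by
  classical
  have hpos : ∀ u, 0 < abv (z + f u) := fun u => lt_of_lt_of_le one_pos (hz u)
  have hs : ∑ u : U, (z + f u)⁻¹ = ∑ u : U, (z - f u)⁻¹ := by
    rw [← Equiv.sum_comp (Equiv.neg U)]
    simp only [Equiv.neg_apply, map_neg, sub_eq_add_neg]
  have hz' : ∀ u, z - f u = z + f (-u) := fun u => by simp [sub_eq_add_neg]
  rw [hs, sum_inv_sub f hf z, map_mul, map_inv₀, map_prod]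
  · refine (mul_le_of_le_one_left (Finset.prod_nonneg fun _ _ => abv.nonneg _) ?_).trans ?_
    · exact inv_le_one_of_one_le₀ (by simpa using hz 0)
    · refine (Finset.prod_le_prod (fun _ _ => abv.nonneg _) (g := fun _ => κ) fun u _ => ?_).trans ?_
      · rw [map_div₀, hz', div_le_iff₀ (hpos _)]
        exact hle _ _
      · simp [Finset.card_erase_of_mem]
  · intro u h
    have := hpos (-u)
    rw [← hz', h] at this
    simp at this

theorem abv_sum_le (abv : AbsoluteValue L ℝ) (hna : IsNonarchimedean abv) {ι : Type*}
    (s : Finset ι) (g : ι → L) {r : ℝ} (hr : 0 ≤ r) (h : ∀ i ∈ s, abv (g i) ≤ r) :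
    abv (∑ i ∈ s, g i) ≤ r := by
  classical
  induction s using Finset.induction_on with
  | empty => simpa using hr
  | insert a s ha ih =>
    rw [Finset.sum_insert ha]
    exact (hna _ _).trans (max_le (h a (by simp)) (ih fun i hi => h i (by simp [hi])))

/-- The weight is constant on each fibre of `φ`, and a nonempty fibre is a coset of `ker φ`, a space
with at least `|U| / q ≥ n + 1` elements, to which the unweighted estimate applies. -/
theorem abv_sum_mul_inv_add_le (abv : AbsoluteValue L ℝ)
    (hna : IsNonarchimedean abv) (f : U →ₗ[F] L) (hf : Function.Injective f)
    (z : L) (κ : ℝ) (hκ : 0 ≤ κ) (hκ1 : κ ≤ 1) (hz : ∀ u, 1 ≤ abv (z + f u))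
    (hle : ∀ u v, abv (f u) ≤ κ * abv (z + f v)) (φ : U →ₗ[F] F) (c : F)
    (habv : ∀ x : F, abv (algebraMap F L x) ≤ 1)
    (n : ℕ) (hn : Fintype.card F * (n + 1) ≤ Fintype.card U) :
    abv (∑ u : U, algebraMap F L (c + φ u) * (z + f u)⁻¹) ≤ κ ^ n := by
  classical
  rw [← Finset.sum_fiberwise _ φ]
  refine abv_sum_le abv hna _ _ (pow_nonneg hκ n) fun x _ => ?_
  have h1 : ∑ u with φ u = x, algebraMap F L (c + φ u) * (z + f u)⁻¹ =
      algebraMap F L (c + x) * ∑ u with φ u = x, (z + f u)⁻¹ := by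
    rw [Finset.mul_sum]
    refine Finset.sum_congr rfl fun u hu => ?_
    rw [(Finset.mem_filter.mp hu).2]
  rw [h1, map_mul]
  refine (mul_le_of_le_one_left (abv.nonneg _) (habv _)).trans ?_
  by_cases hx : ∃ u₀, φ u₀ = x
  · obtain ⟨u₀, rfl⟩ := hx
    have h2 : ∑ u with φ u = φ u₀, (z + f u)⁻¹ =
        ∑ v : LinearMap.ker φ, ((z + f u₀) + (f ∘ₗ (LinearMap.ker φ).subtype) v)⁻¹ := by
      symm
      refine Finset.sum_bij (fun v _ => u₀ + v) ?_ ?_ ?_ ?_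
      · intro v _; simp [LinearMap.mem_ker.mp v.2]
      · intro v _ w _ h; exact Subtype.ext (add_left_cancel h)
      · intro u hu
        exact ⟨⟨u - u₀, by simp [(Finset.mem_filter.mp hu).2]⟩, Finset.mem_univ _, by simp⟩
      · intro v _; simp [add_assoc]
    rw [h2]
    refine (abv_sum_inv_add_le abv (f ∘ₗ (LinearMap.ker φ).subtype).toAddMonoidHom
      (hf.comp (LinearMap.ker φ).injective_subtype) (z + f u₀) κ (fun u => ?_)
      fun u v => ?_).trans (pow_le_pow_of_le_one hκ hκ1 ?_)
    · simpa [add_assoc] using hz (u₀ + u)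
    · simpa [add_assoc] using hle u (u₀ + v)
    · have h3 : Fintype.card U ≤ Fintype.card (LinearMap.ker φ) * Fintype.card F := by
        have e := Submodule.card_eq_card_quotient_mul_card (LinearMap.ker φ)
        have e2 := Nat.card_congr φ.quotKerEquivRange.toEquiv
        have e3 := Nat.card_le_card_of_injective _ (LinearMap.range φ).injective_subtype
        simp only [Nat.card_eq_fintype_card] at e e2 e3
        rw [e]
        have : Fintype.card (U ⧸ LinearMap.ker φ) ≤ Fintype.card F := e2.trans_le e3
        gcongr
      have : n + 1 ≤ Fintype.card (LinearMap.ker φ) := by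
        have := hn.trans h3
        rw [mul_comm] at this
        exact Nat.le_of_mul_le_mul_right this Fintype.card_pos
      omega
  · rw [Finset.filter_false_of_mem fun u _ h => hx ⟨u, h⟩]
    simpa using pow_nonneg hκ n

end PowerSums

/-! ### Functions with a single pole -/

section Valuations

open Polynomial

variable {F K : Type*} [Field F] [Field K] [Algebra F K]
  {Γ₀ : Type*} [LinearOrderedCommGroupWithZero Γ₀] (v : Valuation K Γ₀)

theorem val_algebraMap_eq_one (hv : ∀ c : F, v (algebraMap F K c) ≤ 1) {c : F} (hc : c ≠ 0) :
    v (algebraMap F K c) = 1 := by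
  refine le_antisymm (hv c) ?_
  have h := hv c⁻¹
  rw [map_inv₀, map_inv₀] at h
  have h0 : v (algebraMap F K c) ≠ 0 := by simpa using hc
  exact (inv_le_one₀ (zero_lt_iff.mpr h0)).mp h

theorem val_aeval_le_one (hv : ∀ c : F, v (algebraMap F K c) ≤ 1) {y : K} (hy : v y ≤ 1)
    (p : F[X]) : v (aeval y p) ≤ 1 := by
  rw [aeval_eq_sum_range]
  refine v.map_sum_le fun i _ => ?_
  rw [Algebra.smul_def, map_mul, map_pow]
  exact mul_le_one' (hv _) (pow_le_one' hy _)

theorem val_aeval_eq_one (hv : ∀ c : F, v (algebraMap F K c) ≤ 1) {y : K} (hy : v y < 1)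
    {p : F[X]} (hp : p.coeff 0 ≠ 0) : v (aeval y p) = 1 := by
  have h : aeval y p = aeval y p.divX * y + algebraMap F K (p.coeff 0) := by
    conv_lhs => rw [← divX_mul_X_add p]
    simp
  rw [h, v.map_add_eq_of_lt_right, val_algebraMap_eq_one v hv hp]
  rw [val_algebraMap_eq_one v hv hp, map_mul]
  exact (mul_le_of_le_one_left' (val_aeval_le_one v hv hy.le _)).trans_lt hy

theorem val_aeval_of_one_lt (hv : ∀ c : F, v (algebraMap F K c) ≤ 1) {h : K} (hh : 1 < v h)
    {p : F[X]} (hp : p ≠ 0) : v (aeval h p) = v h ^ p.natDegree := by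
  have h0 : h ≠ 0 := by rintro rfl; simp at hh
  have hval : v (aeval h⁻¹ p.reverse) = 1 := by
    refine val_aeval_eq_one v hv ?_ ?_
    · rw [map_inv₀]; exact inv_lt_one_of_one_lt₀ hh
    · simpa using hp
  have e : aeval h p = aeval h⁻¹ p.reverse * h ^ p.natDegree := by
    let := invertibleOfNonzero h0
    have := eval₂_reverse_mul_pow (algebraMap F K) h p
    rw [invOf_eq_inv] at this
    exact this.symm
  rw [e, map_mul, map_pow, hval, one_mul]

theorem exists_pow_isIdempotentElem {R : Type*} [Monoid R] [Finite R] (g : R) :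
    ∃ M, 0 < M ∧ g ^ M * g ^ M = g ^ M := by
  obtain ⟨a, b, hab, h⟩ : ∃ a b, a < b ∧ g ^ a = g ^ b := by
    obtain ⟨a, b, hne, h⟩ := Finite.exists_ne_map_eq_of_infinite (fun n : ℕ => g ^ n)
    rcases lt_or_gt_of_ne hne with h1 | h1
    · exact ⟨a, b, h1, h⟩
    · exact ⟨b, a, h1, h.symm⟩
  have h1 : ∀ n, a ≤ n → g ^ (n + (b - a)) = g ^ n := by
    intro n hn
    rw [show n + (b - a) = (n - a) + b by omega, pow_add, ← h, ← pow_add]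
    congr 1; omega
  have h2 : ∀ t n, a ≤ n → g ^ (n + t * (b - a)) = g ^ n := by
    intro t
    induction t with
    | zero => simp
    | succ t ih =>
      intro n hn
      rw [Nat.succ_mul, ← add_assoc, h1 _ (by omega), ih n hn]
  have h3 : a ≤ (a + 1) * (b - a) := by
    have : 1 ≤ b - a := by omega
    nlinarith
  refine ⟨(a + 1) * (b - a), by have : 1 ≤ b - a := by omega
                                positivity, ?_⟩
  rw [← pow_add, h2 _ _ h3]

variable (F) in
/-- The valuation ring `O` contains the constants and `y` is a non-unit of it. -/
def Dominates (y : K) (O : ValuationSubring K) : Prop :=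
  (∀ c : F, algebraMap F K c ∈ O) ∧ O.valuation y < 1

theorem mem_iff_val {O : ValuationSubring K} {x : K} : x ∈ O ↔ O.valuation x ≤ 1 :=
  (O.valuation_le_one_iff x).symm

theorem Dominates.val_const {y : K} {O : ValuationSubring K} (h : Dominates F y O) (c : F) :
    O.valuation (algebraMap F K c) ≤ 1 := mem_iff_val.mp (h.1 c)

variable (F) in
/-- The elements of `K` that are regular at every zero of `y`. -/
def coRing (y : K) : Subalgebra F K where
  carrier := {z | ∀ O, Dominates F y O → z ∈ O}
  mul_mem' hx hy O h := O.mul_mem _ _ (hx O h) (hy O h)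
  add_mem' hx hy O h := O.add_mem _ _ (hx O h) (hy O h)
  algebraMap_mem' c _ h := h.1 c

theorem self_mem_coRing (y : K) : y ∈ coRing F y := fun _ h => mem_iff_val.mpr h.2.le

-- On the rational subfield all zeros of `y` look alike: the order `k` of `z` with respect to `y` is
-- the same at each of them.
open IntermediateField in
theorem exists_eq_zpow_mul_of_mem_adjoin {y : K} (hy0 : y ≠ 0) {z : K} (hz : z ∈ F⟮y⟯)
    (hz0 : z ≠ 0) :
    ∃ (k : ℤ) (w : K), z = y ^ k * w ∧ ∀ O, Dominates F y O → O.valuation w = 1 := by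
  have key : ∀ p : F[X], aeval y p ≠ 0 → ∃ (k : ℕ) (w : K), aeval y p = y ^ k * w ∧
      ∀ O, Dominates F y O → O.valuation w = 1 := by
    intro p hp
    have hp0 : p ≠ 0 := by rintro rfl; simp at hp
    obtain ⟨r, hr, hr0⟩ := Polynomial.exists_eq_pow_rootMultiplicity_mul_and_not_dvd p hp0 0
    refine ⟨p.rootMultiplicity 0, aeval y r, ?_, fun O hO => ?_⟩
    · conv_lhs => rw [hr]
      simp
    · refine val_aeval_eq_one O.valuation hO.val_const hO.2 ?_
      rwa [C_0, sub_zero, X_dvd_iff] at hr0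
  obtain ⟨r, s, rfl⟩ := (mem_adjoin_simple_iff F z).mp hz
  have hr : aeval y r ≠ 0 := by rintro h; simp [h] at hz0
  have hs : aeval y s ≠ 0 := by rintro h; simp [h] at hz0
  obtain ⟨k, w, h1, h2⟩ := key r hr
  obtain ⟨l, w', h1', h2'⟩ := key s hs
  refine ⟨k - l, w / w', ?_, fun O hO => by rw [map_div₀, h2 O hO, h2' O hO, div_one]⟩
  rw [h1, h1', zpow_sub₀ hy0, zpow_natCast, zpow_natCast, mul_div_mul_comm]

variable {O₀ : ValuationSubring K} {y : K}

open IntermediateField in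
theorem mul_of_mem_adjoin_of_val_lt_one (hy0 : y ≠ 0) (h₀ : Dominates F y O₀) {z : K}
    (hz : z ∈ F⟮y⟯) (hv : O₀.valuation z < 1) : ∃ d ∈ coRing F y, z = y * d := by
  by_cases hz0 : z = 0
  · exact ⟨0, zero_mem _, by simp [hz0]⟩
  obtain ⟨k, w, rfl, hw⟩ := exists_eq_zpow_mul_of_mem_adjoin hy0 hz hz0
  have hk : 0 < k := by
    by_contra hk
    obtain ⟨n, rfl⟩ : ∃ n : ℕ, k = -n := ⟨(-k).toNat, by omega⟩
    rw [map_mul, hw _ h₀, mul_one, map_zpow₀, zpow_neg, zpow_natCast] at hv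
    have h1 : O₀.valuation y ^ n ≤ 1 := pow_le_one' h₀.2.le n
    have h2 : (0 : O₀.ValueGroup) < O₀.valuation y ^ n := by
      refine pow_pos (zero_lt_iff.mpr ?_) n
      simpa using hy0
    exact absurd ((one_le_inv₀ h2).mpr h1) (not_le.mpr hv)
  obtain ⟨n, rfl⟩ : ∃ n : ℕ, k = n + 1 := ⟨(k - 1).toNat, by omega⟩
  refine ⟨y ^ n * w, mul_mem (pow_mem (self_mem_coRing y) n)
    fun O hO => mem_iff_val.mpr (hw O hO).le, ?_⟩
  rw [zpow_add₀ hy0, zpow_natCast, zpow_one]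
  ring

open IntermediateField in
theorem const_add_of_mem_adjoin (hy0 : y ≠ 0) (h₀ : Dominates F y O₀)
    (hr : ∀ x ∈ O₀, ∃ c : F, O₀.valuation (x - algebraMap F K c) < 1) {z : K}
    (hz : z ∈ F⟮y⟯) (hv : O₀.valuation z ≤ 1) :
    ∃ c : F, ∃ d ∈ coRing F y, z = algebraMap F K c + y * d := by
  obtain ⟨c, hc⟩ := hr z (mem_iff_val.mpr hv)
  obtain ⟨d, hd, h⟩ := mul_of_mem_adjoin_of_val_lt_one hy0 h₀
    (sub_mem hz (F⟮y⟯.algebraMap_mem c)) hc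
  exact ⟨c, d, hd, by rw [← h]; ring⟩

variable (F) in
/-- The ideal generated by `y` in the ring of elements regular at the zeros of `y`. -/
def coIdeal (y : K) : Ideal (coRing F y) := Ideal.span {⟨y, self_mem_coRing y⟩}

theorem mem_coIdeal {z : coRing F y} : z ∈ coIdeal F y ↔ ∃ d ∈ coRing F y, (z : K) = y * d := by
  rw [coIdeal, Ideal.mem_span_singleton]
  constructor
  · rintro ⟨d, rfl⟩; exact ⟨d, d.2, rfl⟩
  · rintro ⟨d, hd, h⟩; exact ⟨⟨d, hd⟩, Subtype.ext h⟩

-- A relation is divided by its coefficient that is largest at `O₀`. Each quotient is then a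
-- constant plus a multiple of `y`, so reduction modulo `y` gives a relation over `F`; all its
-- constants vanish, whereas the quotient equal to `1` has a nonzero one.
open IntermediateField in
theorem linearIndependent_of_quotient (hy0 : y ≠ 0) (h₀ : Dominates F y O₀)
    (hr : ∀ x ∈ O₀, ∃ c : F, O₀.valuation (x - algebraMap F K c) < 1)
    {ι : Type*} [Fintype ι] (u : ι → coRing F y)
    (hu : LinearIndependent F fun i => Ideal.Quotient.mk (coIdeal F y) (u i)) :
    LinearIndependent F⟮y⟯ fun i => (u i : K) := by
  rw [Fintype.linearIndependent_iff]
  intro g hg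
  by_contra hne
  push Not at hne
  obtain ⟨j, hj⟩ := hne
  obtain ⟨m, -, hm⟩ := Finset.exists_max_image Finset.univ
    (fun i => O₀.valuation (g i : K)) ⟨j, Finset.mem_univ j⟩
  have hm0 : (g m : K) ≠ 0 := by
    intro h
    have := hm j (Finset.mem_univ j)
    rw [h, map_zero, le_zero_iff, map_eq_zero] at this
    exact hj (Subtype.ext this)
  have hz : ∀ i, ∃ c : F, ∃ d ∈ coRing F y, (g i : K) / g m = algebraMap F K c + y * d := by
    intro i
    refine const_add_of_mem_adjoin hy0 h₀ hr (div_mem (g i).2 (g m).2) ?_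
    rw [map_div₀]
    exact div_le_one_of_le₀ (hm i (Finset.mem_univ i)) zero_le
  choose c d hd hcd using hz
  have hsum : ∑ i, c i • Ideal.Quotient.mk (coIdeal F y) (u i) = 0 := by
    have h1 : ∑ i, c i • Ideal.Quotient.mk (coIdeal F y) (u i) =
        Ideal.Quotient.mk (coIdeal F y) (∑ i, c i • u i) := by
      simp only [map_sum]; rfl
    rw [h1, Ideal.Quotient.eq_zero_iff_mem, mem_coIdeal]
    refine ⟨-∑ i, d i * u i, neg_mem (sum_mem fun i _ => mul_mem (hd i) (u i).2), ?_⟩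
    have h2 : ∑ i, ((g i : K) / g m) * u i = 0 := by
      have : ∑ i, ((g i : K) / g m) * u i = (∑ i, g i • (u i : K)) / g m := by
        rw [Finset.sum_div]
        refine Finset.sum_congr rfl fun i _ => ?_
        rw [IntermediateField.smul_def, smul_eq_mul]; ring
      rw [this, hg, zero_div]
    simp only [hcd, add_mul, Finset.sum_add_distrib] at h2
    rw [mul_neg, Finset.mul_sum]
    rw [show (((∑ i, c i • u i : coRing F y)) : K) = ∑ i, algebraMap F K (c i) * u i by
      simp [Algebra.smul_def]]
    rw [eq_neg_iff_add_eq_zero, ← h2]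
    congr 1
    exact Finset.sum_congr rfl fun i _ => by ring
  have hc0 := (Fintype.linearIndependent_iff.mp hu) c hsum m
  have h1 := hcd m
  rw [div_self hm0, hc0, map_zero, zero_add] at h1
  have h2 : O₀.valuation (y * d m) < 1 := by
    rw [map_mul]
    exact (mul_le_of_le_one_right' (mem_iff_val.mp (hd m _ h₀))).trans_lt h₀.2
  rw [← h1, map_one] at h2
  exact lt_irrefl _ h2

open IntermediateField in
theorem rank_quotient_coIdeal_le (hy0 : y ≠ 0) (h₀ : Dominates F y O₀)
    (hr : ∀ x ∈ O₀, ∃ c : F, O₀.valuation (x - algebraMap F K c) < 1)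
    [FiniteDimensional F⟮y⟯ K] :
    Module.rank F (coRing F y ⧸ coIdeal F y) ≤ (Module.finrank F⟮y⟯ K : ℕ) := by
  refine rank_le fun s hs => ?_
  have h := linearIndependent_of_quotient hy0 h₀ hr
    (fun i : s => Quotient.out (i : coRing F y ⧸ coIdeal F y)) (by
    convert hs with i
    exact Ideal.Quotient.mk_out (i : coRing F y ⧸ coIdeal F y))
  have h1 := h.fintype_card_le_finrank
  rwa [Fintype.card_coe] at h1

open IntermediateField in
theorem finite_quotient_coIdeal [Finite F] (hy0 : y ≠ 0) (h₀ : Dominates F y O₀)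
    (hr : ∀ x ∈ O₀, ∃ c : F, O₀.valuation (x - algebraMap F K c) < 1)
    [FiniteDimensional F⟮y⟯ K] :
    Finite (coRing F y ⧸ coIdeal F y) ∧
      Nat.card (coRing F y ⧸ coIdeal F y) ≤ Nat.card F ^ Module.finrank F⟮y⟯ K := by
  have h := rank_quotient_coIdeal_le hy0 h₀ hr
  have h0 : Module.Free F (coRing F y ⧸ coIdeal F y) := Module.Free.of_divisionRing _ _
  have h1 : Module.Finite F (coRing F y ⧸ coIdeal F y) :=
    Module.rank_lt_aleph0_iff.mp (h.trans_lt Cardinal.natCast_lt_aleph0)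
  have h2 : Finite (coRing F y ⧸ coIdeal F y) := Module.finite_of_finite F
  refine ⟨h2, ?_⟩
  rw [Module.natCard_eq_pow_finrank (K := F)]
  exact Nat.pow_le_pow_right Nat.card_pos (Module.finrank_le_of_rank_le h)

end Valuations

/-! ### Separating a rational place from the other zeros of `y` -/

section Valuations

open Polynomial

variable {F K : Type*} [Field F] [Field K] [Algebra F K] {O₀ : ValuationSubring K} {y : K}

/-- A valuation ring over `F` inside `O₀` is all of `O₀`: the inverse of a nonzero non-unit of `O₀`
is outside `O₀`, so the smaller ring contains the non-unit itself, and constants supply the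
remaining residues. -/
theorem not_le_of_ne (hr : ∀ x ∈ O₀, ∃ c : F, O₀.valuation (x - algebraMap F K c) < 1)
    {O : ValuationSubring K} (hO : ∀ c : F, algebraMap F K c ∈ O) (hne : O ≠ O₀) :
    ∃ u ∈ O, u ∉ O₀ := by
  by_contra! hle
  refine hne (le_antisymm hle fun x hx => ?_)
  obtain ⟨c, hc⟩ := hr x hx
  have h1 : x - algebraMap F K c ∈ O := by
    rcases O.mem_or_inv_mem (x - algebraMap F K c) with h | h
    · exact h
    · rcases O₀.mem_nonunits_iff_or.mp (O₀.mem_nonunits_iff.mpr hc) with h0 | h0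
      · rw [h0]; exact O.zero_mem
      · exact absurd (hle _ h) h0
  simpa using O.add_mem _ _ h1 (hO c)

/-- The tails of a polynomial relation for `u` are regular whether or not `u` is. Where `u` is
regular this is clear; elsewhere `u⁻¹` is regular, and the tails are computed from the zeroth one,
which vanishes, by repeated multiplication by `u⁻¹`. -/
theorem mem_coRing_tail {n : ℕ} {a : ℕ → K} (ha : ∀ i, a i ∈ coRing F y)
    (han : ∀ i, n < i → a i = 0) {u : K} (hu : ∑ i ∈ Finset.range (n + 1), a i * u ^ i = 0)
    (k : ℕ) :
    (∑ i ∈ Finset.range (n + 1), a (k + i) * u ^ i ∈ coRing F y) ∧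
    (u * ∑ i ∈ Finset.range (n + 1), a (k + 1 + i) * u ^ i ∈ coRing F y) ∧
    a k = ∑ i ∈ Finset.range (n + 1), a (k + i) * u ^ i -
      u * ∑ i ∈ Finset.range (n + 1), a (k + 1 + i) * u ^ i := by
  set s : ℕ → K := fun k => ∑ i ∈ Finset.range (n + 1), a (k + i) * u ^ i with hs
  have hrec : ∀ k, a k = s k - u * s (k + 1) := by
    intro k
    simp only [hs]
    rw [Finset.sum_range_succ', Finset.sum_range_succ _ n, han (k + 1 + n) (by omega), zero_mul,
      add_zero (Finset.sum _ _), Finset.mul_sum, eq_sub_iff_add_eq, pow_zero, mul_one, add_zero,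
      add_comm]
    congr 1
    refine Finset.sum_congr rfl fun i _ => ?_
    rw [show k + (i + 1) = k + 1 + i by omega]
    ring
  have hmem : ∀ k, s k ∈ coRing F y := by
    intro k O hO
    by_cases huO : u ∈ O
    · exact sum_mem fun i _ => mul_mem (ha _ O hO) (pow_mem huO i)
    · have hui : u⁻¹ ∈ O := (O.mem_or_inv_mem u).resolve_left huO
      have hu0 : u ≠ 0 := by rintro rfl; exact huO O.zero_mem
      induction k with
      | zero =>
        have : s 0 = 0 := by simpa [hs] using hu
        rw [this]; exact O.zero_mem
      | succ k ih =>
        have : s (k + 1) = u⁻¹ * (s k - a k) := by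
          rw [hrec k]; field_simp; ring
        rw [this]
        exact mul_mem hui (sub_mem ih (ha k O hO))
  refine ⟨hmem k, ?_, hrec k⟩
  have : u * s (k + 1) = s k - a k := by rw [hrec k]; ring
  change u * s (k + 1) ∈ _
  rw [this]
  exact sub_mem (hmem k) (ha k)

open IntermediateField in
/-- Every element `u` outside of `O₀` is a quotient of elements regular at the zeros of `y`, the
numerator being a unit of `O₀`. -/
theorem exists_mul_mem_coRing (hy0 : y ≠ 0) (h₀ : Dominates F y O₀)
    (hr : ∀ x ∈ O₀, ∃ c : F, O₀.valuation (x - algebraMap F K c) < 1)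
    [FiniteDimensional F⟮y⟯ K] {u : K} (hu : u ∉ O₀) :
    ∃ s ∈ coRing F y, u * s ∈ coRing F y ∧ O₀.valuation (u * s) = 1 := by
  obtain ⟨p, hp0, hp⟩ := (Algebra.IsAlgebraic.isAlgebraic (R := F⟮y⟯) u)
  -- Dividing by the coefficient that is largest at `O₀` makes all coefficients regular at the zeros
  -- of `y`, and the `m`-th one equal to `1`.
  obtain ⟨m, hm, hmax⟩ := Finset.exists_max_image p.support
    (fun i => O₀.valuation (p.coeff i : K)) (Polynomial.support_nonempty.mpr hp0)
  have hm0 : (p.coeff m : K) ≠ 0 := by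
    simpa using Polynomial.mem_support_iff.mp hm
  set a : ℕ → K := fun i => (p.coeff i : K) / p.coeff m with ha
  have hamem : ∀ i, a i ∈ coRing F y := by
    intro i
    have hval : O₀.valuation (a i) ≤ 1 := by
      simp only [ha, map_div₀]
      refine div_le_one_of_le₀ ?_ zero_le
      by_cases hi : i ∈ p.support
      · exact hmax i hi
      · rw [Polynomial.notMem_support_iff.mp hi]; simp
    obtain ⟨c, d, hd, h⟩ := const_add_of_mem_adjoin hy0 h₀ hr
      (div_mem (p.coeff i).2 (p.coeff m).2) hval
    rw [show a i = _ from h]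
    exact add_mem (Subalgebra.algebraMap_mem _ c) (mul_mem (self_mem_coRing y) hd)
  have han : ∀ i, p.natDegree < i → a i = 0 := by
    intro i hi
    simp [ha, Polynomial.coeff_eq_zero_of_natDegree_lt hi]
  have hsum : ∑ i ∈ Finset.range (p.natDegree + 1), a i * u ^ i = 0 := by
    rw [aeval_eq_sum_range] at hp
    have : ∑ i ∈ Finset.range (p.natDegree + 1), a i * u ^ i =
        (∑ i ∈ Finset.range (p.natDegree + 1), p.coeff i • u ^ i) / p.coeff m := by
      rw [Finset.sum_div]
      refine Finset.sum_congr rfl fun i _ => ?_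
      rw [IntermediateField.smul_def, smul_eq_mul]
      simp only [ha]; ring
    rw [this, hp, zero_div]
  have huv : 1 < O₀.valuation u := by
    rw [← not_le, ← mem_iff_val]; exact hu
  set s : ℕ → K := fun k => ∑ i ∈ Finset.range (p.natDegree + 1), a (k + i) * u ^ i with hs
  have hall := fun k => mem_coRing_tail hamem han hsum k
  have hs0 : s 0 = 0 := by simpa [hs] using hsum
  have hus : ∀ k, O₀.valuation (u * s k) ≤ 1 := by
    intro k
    cases k with
    | zero => simp [hs0]
    | succ k => exact mem_iff_val.mp ((hall k).2.1 _ h₀)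
  -- Since `u` has a pole at `O₀` but `u * s m` has none, `s m` vanishes there. Then `1 = a m = s m
  -- - u * s (m + 1)` forces `u * s (m + 1)` to be a unit.
  have hslt : O₀.valuation (s m) < 1 := by
    by_contra hge
    have := hus m
    rw [map_mul] at this
    exact absurd this (not_le.mpr (lt_of_lt_of_le huv (le_mul_of_one_le_right' (not_lt.mp hge))))
  refine ⟨s (m + 1), (hall (m + 1)).1, (hall m).2.1, le_antisymm (hus _) ?_⟩
  by_contra hlt
  have h1 : O₀.valuation (a m) < 1 := by
    rw [(hall m).2.2]
    exact Valuation.map_sub_lt _ hslt (not_le.mp hlt)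
  rw [show a m = 1 from div_self hm0, map_one] at h1
  exact lt_irrefl _ h1

-- The quotient modulo `y` is finite, so some positive power of each of its elements is idempotent.
open IntermediateField in
theorem exists_pow_mul_one_sub [Finite F] (hy0 : y ≠ 0) (h₀ : Dominates F y O₀)
    (hr : ∀ x ∈ O₀, ∃ c : F, O₀.valuation (x - algebraMap F K c) < 1)
    [FiniteDimensional F⟮y⟯ K] {g : K} (hg : g ∈ coRing F y) :
    ∃ M, 0 < M ∧ ∃ d ∈ coRing F y, g ^ M * (1 - g ^ M) = y * d := by
  have := (finite_quotient_coIdeal hy0 h₀ hr).1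
  obtain ⟨M, hM, h⟩ := exists_pow_isIdempotentElem (Ideal.Quotient.mk (coIdeal F y) ⟨g, hg⟩)
  refine ⟨M, hM, ?_⟩
  rw [← map_pow, ← map_mul, eq_comm, Ideal.Quotient.mk_eq_mk_iff_sub_mem, mem_coIdeal] at h
  obtain ⟨d, hd, h⟩ := h
  refine ⟨d, hd, ?_⟩
  rw [← h]
  simp only [AddSubgroupClass.coe_sub, MulMemClass.coe_mul, SubmonoidClass.coe_pow]
  ring

open IntermediateField in
theorem exists_separating [Finite F] (hy0 : y ≠ 0) (h₀ : Dominates F y O₀)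
    (hr : ∀ x ∈ O₀, ∃ c : F, O₀.valuation (x - algebraMap F K c) < 1)
    [FiniteDimensional F⟮y⟯ K] {O : ValuationSubring K} (hO : Dominates F y O) (hne : O ≠ O₀) :
    ∃ e ∈ coRing F y, O.valuation e < 1 ∧ O₀.valuation (e - 1) < 1 := by
  obtain ⟨u, huO, hu⟩ := not_le_of_ne hr hO.1 hne
  obtain ⟨s, hs, hus, hval⟩ := exists_mul_mem_coRing hy0 h₀ hr hu
  have huv : 1 < O₀.valuation u := by
    rw [← not_le, ← mem_iff_val]; exact hu
  -- The element `u * s` is a unit at `O₀`. If it vanishes at `O`, a constant multiple of it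
  -- separates. If not, `s` is a unit at `O` and vanishes at `O₀`, and an idempotent power of `s`
  -- modulo `y` gives `1 - s ^ M`.
  rcases (mem_iff_val.mp (hus _ hO)).lt_or_eq with h1 | h1
  · obtain ⟨c, hc⟩ := hr _ (hus _ h₀)
    have hc0 : c ≠ 0 := by
      rintro rfl
      rw [map_zero, sub_zero, hval] at hc
      exact lt_irrefl _ hc
    have hc0' : algebraMap F K c ≠ 0 := by simpa using hc0
    refine ⟨algebraMap F K c⁻¹ * (u * s), mul_mem (Subalgebra.algebraMap_mem _ _) hus, ?_, ?_⟩
    · rw [map_mul]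
      exact (mul_le_of_le_one_left' (hO.val_const _)).trans_lt h1
    · have : algebraMap F K c⁻¹ * (u * s) - 1 = algebraMap F K c⁻¹ * (u * s - algebraMap F K c) := by
        rw [mul_sub, map_inv₀, inv_mul_cancel₀ hc0']
      rw [this, map_mul]
      exact (mul_le_of_le_one_left' (h₀.val_const _)).trans_lt hc
  · have hs1 : O.valuation s = 1 := by
      refine le_antisymm (mem_iff_val.mp (hs _ hO)) ?_
      rw [← h1, map_mul]
      exact mul_le_of_le_one_left' (mem_iff_val.mp huO)
    have hs0 : O₀.valuation s < 1 := by
      by_contra hge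
      rw [map_mul] at hval
      exact absurd hval (lt_of_lt_of_le huv (le_mul_of_one_le_right' (not_lt.mp hge))).ne'
    obtain ⟨M, hM, d, hd, h⟩ := exists_pow_mul_one_sub hy0 h₀ hr hs
    refine ⟨1 - s ^ M, sub_mem (one_mem _) (pow_mem hs M), ?_, ?_⟩
    · have h2 := congrArg O.valuation h
      rw [map_mul, map_pow, hs1, one_pow, one_mul, map_mul] at h2
      rw [h2]
      exact (mul_le_of_le_one_right' (mem_iff_val.mp (hd _ hO))).trans_lt hO.2
    · rw [show 1 - s ^ M - 1 = -s ^ M by ring, Valuation.map_neg, map_pow]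
      exact pow_lt_one₀ zero_le hs0 hM.ne'

theorem val_prod_sub_one_lt {Γ₀ : Type*} [LinearOrderedCommGroupWithZero Γ₀] (v : Valuation K Γ₀)
    {ι : Type*} (s : Finset ι) (f : ι → K) (h : ∀ i ∈ s, v (f i - 1) < 1) :
    v (∏ i ∈ s, f i - 1) < 1 := by
  refine Finset.prod_induction f (fun z => v (z - 1) < 1) (fun a b ha hb => ?_) (by simp) h
  have : a * b - 1 = (a - 1) * (b - 1) + ((a - 1) + (b - 1)) := by ring
  rw [this]
  refine v.map_add_lt ?_ (v.map_add_lt ha hb)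
  rw [map_mul]
  exact (mul_le_of_le_one_left' ha.le).trans_lt hb

-- Finiteness modulo `y` replaces finiteness of the set of zeros of `y`: whether an element vanishes
-- at a zero of `y` depends only on its class. The product `e` of representatives of all classes
-- congruent to `1` at `O₀` thus vanishes at every other zero. Once `e ^ M` is idempotent modulo
-- `y`, it is divisible by `y` at those zeros and a unit at `O₀`, so that `e ^ M / y` has the
-- required pole.
open IntermediateField in
theorem exists_pole [Finite F] (hy0 : y ≠ 0) (h₀ : Dominates F y O₀)
    (hr : ∀ x ∈ O₀, ∃ c : F, O₀.valuation (x - algebraMap F K c) < 1)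
    [FiniteDimensional F⟮y⟯ K] :
    ∃ h : K, y * h ∈ coRing F y ∧ 1 < O₀.valuation h ∧
      ∀ O, Dominates F y O → O ≠ O₀ → h ∈ O := by
  classical
  have hfin := (finite_quotient_coIdeal hy0 h₀ hr).1
  have : Fintype (coRing F y ⧸ coIdeal F y) := Fintype.ofFinite _
  set r : coRing F y ⧸ coIdeal F y → coRing F y := fun t => Quotient.out t with hrdef
  set T := Finset.univ.filter fun t => O₀.valuation ((r t : K) - 1) < 1 with hT
  set e : K := ∏ t ∈ T, (r t : K) with he
  have hemem : e ∈ coRing F y := prod_mem fun t _ => (r t).2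
  have he0 : O₀.valuation (e - 1) < 1 :=
    val_prod_sub_one_lt _ _ _ fun t ht => (Finset.mem_filter.mp ht).2
  have heO : ∀ O, Dominates F y O → O ≠ O₀ → O.valuation e < 1 := by
    intro O hO hne
    obtain ⟨f, hf, hf1, hf0⟩ := exists_separating hy0 h₀ hr hO hne
    set t : coRing F y ⧸ coIdeal F y := Ideal.Quotient.mk _ ⟨f, hf⟩ with ht
    have hrt : Ideal.Quotient.mk (coIdeal F y) (r t) = t := Ideal.Quotient.mk_out t
    rw [ht, Ideal.Quotient.mk_eq_mk_iff_sub_mem, mem_coIdeal] at hrt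
    obtain ⟨d, hd, h⟩ := hrt
    have hyd : ∀ O, Dominates F y O → O.valuation (y * d) < 1 := fun O hO => by
      rw [map_mul]
      exact (mul_le_of_le_one_right' (mem_iff_val.mp (hd _ hO))).trans_lt hO.2
    have h' : (r t : K) = f + y * d := by rw [← h]; simp [ht]
    have htT : t ∈ T := by
      refine Finset.mem_filter.mpr ⟨Finset.mem_univ _, ?_⟩
      rw [h', show f + y * d - 1 = (f - 1) + y * d by ring]
      exact Valuation.map_add_lt _ hf0 (hyd _ h₀)
    rw [he, ← Finset.mul_prod_erase _ _ htT, map_mul]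
    refine (mul_le_of_le_one_right' ?_).trans_lt (?_ : O.valuation (r t : K) < 1)
    · exact mem_iff_val.mp (prod_mem fun t _ => (r t).2 _ hO)
    · rw [h']
      exact Valuation.map_add_lt _ hf1 (hyd _ hO)
  obtain ⟨M, hM, d, hd, h⟩ := exists_pow_mul_one_sub hy0 h₀ hr hemem
  refine ⟨e ^ M / y, ?_, ?_, fun O hO hne => ?_⟩
  · rw [mul_div_cancel₀ _ hy0]
    exact pow_mem hemem M
  · have h1 : O₀.valuation e = 1 := by
      have := Valuation.map_add_eq_of_lt_right O₀.valuation (x := e - 1) (y := 1) (by simpa using he0)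
      simpa using this
    rw [map_div₀, map_pow, h1, one_pow, one_div]
    refine one_lt_inv_iff₀.mpr ⟨zero_lt_iff.mpr (by simpa using hy0), h₀.2⟩
  · rw [mem_iff_val, map_div₀]
    refine div_le_one_of_le₀ ?_ zero_le
    have h1 : O.valuation (1 - e ^ M) = 1 := by
      rw [Valuation.map_sub_eq_of_lt_left, map_one]
      rw [map_one, map_pow]
      exact pow_lt_one₀ zero_le (heO O hO hne) hM.ne'
    have h2 := congrArg O.valuation h
    rw [map_mul, h1, mul_one, map_mul] at h2
    rw [h2]
    exact mul_le_of_le_one_right' (mem_iff_val.mp (hd _ hO))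

end Valuations

/-! ### Riemann's theorem by counting -/

section Valuations

open Polynomial

variable {F K : Type*} [Field F] [Field K] [Algebra F K] {O₀ : ValuationSubring K} {y : K}

theorem mem_of_isIntegral_subring {R : Subring K} {O : ValuationSubring K}
    (hR : ∀ x ∈ R, x ∈ O) {u : K} (hu : IsIntegral R u) : u ∈ O := by
  let i : R →+* O := R.subtype.codRestrict O.toSubring fun x => hR x x.2
  obtain ⟨p, hp, hpu⟩ := hu
  have h1 : IsIntegral O u := by
    refine ⟨p.map i, hp.map i, ?_⟩
    rw [eval₂_map]
    exact hpu
  obtain ⟨w, hw⟩ := IsIntegrallyClosed.isIntegral_iff.mp h1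
  rw [← hw]
  exact w.2

open IntermediateField algebraAdjoinAdjoin in
/-- Every element of `K` has a multiple by a polynomial in `z` that is regular outside the poles of
`z`. -/
theorem exists_aeval_mul_mem (z : K) [Algebra.IsAlgebraic F⟮z⟯ K] (u : K) :
    ∃ p : F[X], aeval z p ≠ 0 ∧ ∀ O : ValuationSubring K, (∀ c : F, algebraMap F K c ∈ O) →
      z ∈ O → aeval z p * u ∈ O := by
  have h1 : IsAlgebraic (Algebra.adjoin F {z}) u :=
    (IsFractionRing.isAlgebraic_iff (Algebra.adjoin F {z}) F⟮z⟯ K).mpr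
      (Algebra.IsAlgebraic.isAlgebraic u)
  -- Clearing denominators makes `u` integral over `F[z]`, and valuation rings are integrally
  -- closed.
  obtain ⟨r, hr0, hr⟩ := h1.exists_integral_multiple
  obtain ⟨p, hp⟩ := (Algebra.adjoin_singleton_eq_range_aeval F z).le r.2
  have hp' : aeval z p = r := hp
  refine ⟨p, by rw [hp']; simpa using hr0, fun O hO hz => ?_⟩
  rw [hp']
  refine mem_of_isIntegral_subring (R := (Algebra.adjoin F {z}).toSubring) (fun x hx => ?_) hr
  obtain ⟨p', rfl⟩ := (Algebra.adjoin_singleton_eq_range_aeval F z).le hx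
  exact mem_iff_val.mpr (val_aeval_le_one O.valuation (fun c => mem_iff_val.mp (hO c))
    (mem_iff_val.mp hz) p')

open IntermediateField in
theorem adjoin_inv_eq (y : K) : F⟮y⁻¹⟯ = F⟮y⟯ := by
  refine le_antisymm ?_ ?_
  · rw [adjoin_simple_le_iff]
    exact inv_mem (mem_adjoin_simple_self F y)
  · rw [adjoin_simple_le_iff, ← inv_mem_iff]
    exact mem_adjoin_simple_self F y⁻¹

open IntermediateField in
theorem exists_pow_mul_mem_coRing (hy0 : y ≠ 0) [Algebra.IsAlgebraic F⟮y⟯ K] (u : K) :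
    ∃ c : ℕ, y ^ c * u ∈ coRing F y := by
  obtain ⟨p, hp0, hp⟩ := exists_aeval_mul_mem (F := F) y u
  obtain ⟨k, w, hk, hw⟩ := exists_eq_zpow_mul_of_mem_adjoin (F := F) hy0
    (z := aeval y p) (by
      rw [mem_adjoin_simple_iff]; exact ⟨p, 1, by simp⟩) hp0
  refine ⟨k.toNat, fun O hO => ?_⟩
  have h1 := hp O hO.1 (mem_iff_val.mpr hO.2.le)
  rw [hk, mem_iff_val, map_mul, map_mul, hw O hO, mul_one, ← map_mul, ← mem_iff_val] at h1
  obtain ⟨n, hn⟩ : ∃ n : ℕ, (k.toNat : ℤ) = n + k := ⟨(k.toNat - k).toNat, by omega⟩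
  rw [← zpow_natCast, hn, zpow_add₀ hy0, zpow_natCast, mul_assoc]
  exact O.mul_mem _ _ (pow_mem (mem_iff_val.mpr hO.2.le) n) h1

-- Each vector of an arbitrary basis is multiplied by a polynomial in `y⁻¹` that removes its poles
-- where `y⁻¹` is regular; the poles left, at the zeros of `y`, have bounded order.
open IntermediateField in
theorem exists_regular_basis (hy0 : y ≠ 0) [FiniteDimensional F⟮y⟯ K] :
    ∃ b : Fin (Module.finrank F⟮y⟯ K) → K, LinearIndependent F⟮y⟯ b ∧
      (∀ j, ∀ O : ValuationSubring K, (∀ c : F, algebraMap F K c ∈ O) → y⁻¹ ∈ O → b j ∈ O) ∧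
      ∃ c : ℕ, ∀ j, y ^ c * b j ∈ coRing F y := by
  have hinv : Algebra.IsAlgebraic F⟮y⁻¹⟯ K := by rw [adjoin_inv_eq]; infer_instance
  have b := Module.finBasis F⟮y⟯ K
  choose p hp0 hp using fun j => exists_aeval_mul_mem (F := F) y⁻¹ (b j)
  choose c hc using fun j => exists_pow_mul_mem_coRing (F := F) hy0 (aeval y⁻¹ (p j) * b j)
  have hmem : ∀ j, aeval y⁻¹ (p j) ∈ F⟮y⟯ := fun j => by
    rw [← adjoin_inv_eq, mem_adjoin_simple_iff]; exact ⟨p j, 1, by simp⟩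
  refine ⟨fun j => aeval y⁻¹ (p j) * b j, ?_, hp, Finset.univ.sup c, fun j => ?_⟩
  · have := b.linearIndependent.units_smul
      (fun j => Units.mk0 (⟨aeval y⁻¹ (p j), hmem j⟩ : F⟮y⟯) fun h => hp0 j (congrArg Subtype.val h))
    exact this
  · obtain ⟨n, hn⟩ := Nat.exists_eq_add_of_le (Finset.le_sup (f := c) (Finset.mem_univ j))
    rw [hn, add_comm, pow_add, mul_assoc]
    exact mul_mem (pow_mem (self_mem_coRing y) n) (hc j)

/-- The elements with poles of bounded order at the zeros of `y` fall into finitely many classes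
modulo the elements regular there. -/
theorem exists_classes (hy0 : y ≠ 0) (M : ℕ) :
    ∃ τ : K → Fin M → coRing F y ⧸ coIdeal F y, ∀ z z', y ^ M * z ∈ coRing F y →
      y ^ M * z' ∈ coRing F y → τ z = τ z' → z - z' ∈ coRing F y := by
  classical
  induction M with
  | zero => exact ⟨fun _ => Fin.elim0, fun z z' h h' _ => by simpa using sub_mem h h'⟩
  | succ M ih =>
    obtain ⟨τ, hτ⟩ := ih
    set r : coRing F y ⧸ coIdeal F y → coRing F y := fun t => Quotient.out t with hr
    -- The class of `y ^ (M + 1) * z` is the leading digit of the polar part; `δ` subtracts a fixed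
    -- lift of that digit, which lowers the pole order by one.
    set cl : K → coRing F y ⧸ coIdeal F y := fun z =>
      if h : y ^ (M + 1) * z ∈ coRing F y then Ideal.Quotient.mk _ ⟨_, h⟩ else 0 with hcl
    set δ : K → K := fun z => z - (y ^ (M + 1))⁻¹ * r (cl z) with hδ
    have hpow : y ^ (M + 1) ≠ 0 := pow_ne_zero _ hy0
    have hδmem : ∀ z, y ^ (M + 1) * z ∈ coRing F y → y ^ M * δ z ∈ coRing F y := by
      intro z hz
      have h1 : Ideal.Quotient.mk (coIdeal F y) ⟨_, hz⟩ = Ideal.Quotient.mk _ (r (cl z)) := by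
        rw [show Ideal.Quotient.mk (coIdeal F y) (r (cl z)) = cl z from Ideal.Quotient.mk_out _]
        simp only [hcl, dif_pos hz]
      rw [Ideal.Quotient.mk_eq_mk_iff_sub_mem, mem_coIdeal] at h1
      obtain ⟨d, hd, h⟩ := h1
      have h2 : y ^ M * δ z = d := by
        have h' : y ^ (M + 1) * z - r (cl z) = y * d := h
        apply mul_left_cancel₀ hy0
        rw [← h', hδ]
        simp only
        rw [← mul_assoc, ← pow_succ', mul_sub, mul_inv_cancel_left₀ hpow]
      rwa [h2]
    refine ⟨fun z => Fin.cons (cl z) (τ (δ z)), fun z z' hz hz' h => ?_⟩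
    obtain ⟨h1, h2⟩ := Fin.cons_inj.mp h
    have h3 := hτ _ _ (hδmem z hz) (hδmem z' hz') h2
    simpa [hδ, h1] using h3

open IntermediateField in
/-- Riemann's theorem for a rational place `O₀`, in the weak form of the existence of a function
whose only pole is `O₀`. -/
theorem exists_single_pole [Finite F] (hy0 : y ≠ 0) (h₀ : Dominates F y O₀)
    (hr : ∀ x ∈ O₀, ∃ c : F, O₀.valuation (x - algebraMap F K c) < 1)
    [FiniteDimensional F⟮y⟯ K]
    (hconst : ∀ f : K, (∀ O : ValuationSubring K, (∀ c : F, algebraMap F K c ∈ O) → f ∈ O) →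
      ∃ c : F, algebraMap F K c = f) :
    ∃ f : K, f ∉ O₀ ∧ ∀ O : ValuationSubring K, (∀ c : F, algebraMap F K c ∈ O) →
      O ≠ O₀ → f ∈ O := by
  classical
  by_contra! hcontra
  have := Fintype.ofFinite F
  obtain ⟨h, hyh, hh, hO⟩ := exists_pole hy0 h₀ hr
  set N := Module.finrank F⟮y⟯ K with hN
  obtain ⟨b, hb, hbO, c, hc⟩ : ∃ b : Fin N → K, LinearIndependent F⟮y⟯ b ∧
      (∀ j, ∀ O : ValuationSubring K, (∀ c : F, algebraMap F K c ∈ O) → y⁻¹ ∈ O → b j ∈ O) ∧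
      ∃ c : ℕ, ∀ j, y ^ c * b j ∈ coRing F y := exists_regular_basis hy0
  obtain ⟨hfin, hcard⟩ := finite_quotient_coIdeal hy0 h₀ hr
  have := Fintype.ofFinite (coRing F y ⧸ coIdeal F y)
  -- The value of `n` is what the count below needs: there are `q ^ (n * N + M)` pairs against at
  -- most `q ^ (N * M)` polar parts, and `n * N + M > N * M + 1` amounts to `n + c > N * c + 1`.
  set n := N * c + 2 with hn
  set M := n + c with hM
  obtain ⟨τ, hτ⟩ := exists_classes (F := F) hy0 M
  -- The functions `B f` have poles only at zeros of `y`, and the functions `G g`, polynomials in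
  -- `h` without constant term, have no pole at a zero of `y` other than `O₀`. If `B f + G g` is
  -- regular at all zeros of `y`, then `B f` can have a pole only at `O₀`.
  set B : (Fin N → Fin n → F) → K := fun f =>
    ∑ j, (∑ i : Fin n, algebraMap F K (f j i) * y⁻¹ ^ (i : ℕ)) * b j with hB
  set G : (Fin M → F) → K := fun g =>
    ∑ i : Fin M, algebraMap F K (g i) * h ^ ((i : ℕ) + 1) with hG
  have hBsub : ∀ f f', B f - B f' = B (f - f') := fun f f' => by
    simp [hB, ← Finset.sum_sub_distrib, ← sub_mul]
  have hGsub : ∀ g g', G g - G g' = G (g - g') := fun g g' => by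
    simp [hG, ← Finset.sum_sub_distrib, ← sub_mul]
  have hpoly : ∀ {m : ℕ} (a : Fin m → F) (z : K), 1 < O₀.valuation z →
      O₀.valuation (z * ∑ i, algebraMap F K (a i) * z ^ (i : ℕ)) ≤ 1 → a = 0 := by
    intro m a z hz hle
    set p : F[X] := ∑ i : Fin m, C (a i) * X ^ (i : ℕ) with hp
    have hpe : aeval z (X * p) = z * ∑ i, algebraMap F K (a i) * z ^ (i : ℕ) := by
      simp [hp]
    have hp0 : p = 0 := by
      by_contra hp0
      rw [← hpe, val_aeval_of_one_lt O₀.valuation h₀.val_const hz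
        (mul_ne_zero X_ne_zero hp0)] at hle
      refine absurd hle (not_le.mpr (one_lt_pow₀ hz ?_))
      rw [natDegree_X_mul hp0]; omega
    ext i
    have hi := congrArg (fun r => coeff r (i : ℕ)) hp0
    simp only [hp, finsetSum_coeff, coeff_C_mul, coeff_X_pow, coeff_zero] at hi
    rw [Finset.sum_eq_single i] at hi
    · simpa using hi
    · intro k _ hk
      rw [if_neg (fun e => hk (Fin.ext e.symm)), mul_zero]
    · simp
  have hyv : 1 < O₀.valuation y⁻¹ := by
    rw [map_inv₀]
    exact one_lt_inv_iff₀.mpr ⟨zero_lt_iff.mpr (by simpa using hy0), h₀.2⟩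
  have hG0 : ∀ g, G g ∈ O₀ → g = 0 := by
    intro g hg
    refine hpoly g h hh ?_
    rw [← mem_iff_val]
    convert hg using 1
    simp only [hG, Finset.mul_sum]
    exact Finset.sum_congr rfl fun i _ => by ring
  have hB0 : ∀ f, B f = 0 → f = 0 := by
    intro f hf
    have hmem : ∀ j, ∑ i : Fin n, algebraMap F K (f j i) * y⁻¹ ^ (i : ℕ) ∈ F⟮y⟯ := fun j =>
      sum_mem fun i _ => mul_mem (F⟮y⟯.algebraMap_mem _)
        (pow_mem (inv_mem (mem_adjoin_simple_self F y)) _)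
    have h1 := Fintype.linearIndependent_iff.mp hb (fun j => ⟨_, hmem j⟩) hf
    funext j
    refine hpoly (f j) y⁻¹ hyv ?_
    have h2 : ∑ i : Fin n, algebraMap F K (f j i) * y⁻¹ ^ (i : ℕ) = 0 := congrArg Subtype.val (h1 j)
    rw [h2]
    simp
  have hBM : ∀ f, y ^ M * B f ∈ coRing F y := by
    intro f
    simp only [hB, Finset.mul_sum, Finset.sum_mul]
    refine sum_mem fun j _ => sum_mem fun i _ => ?_
    have : y ^ M * (algebraMap F K (f j i) * y⁻¹ ^ (i : ℕ) * b j) =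
        algebraMap F K (f j i) * y ^ (n - i) * (y ^ c * b j) := by
      have e : y ^ M = y ^ (n - i) * y ^ (i : ℕ) * y ^ c := by
        rw [← pow_add, ← pow_add]; congr 1; omega
      rw [e, inv_pow]
      field_simp
    rw [this]
    exact mul_mem (mul_mem (Subalgebra.algebraMap_mem _ _) (pow_mem (self_mem_coRing y) _)) (hc j)
  have hGM : ∀ g, y ^ M * G g ∈ coRing F y := by
    intro g
    simp only [hG, Finset.mul_sum]
    refine sum_mem fun i _ => ?_
    have : y ^ M * (algebraMap F K (g i) * h ^ ((i : ℕ) + 1)) =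
        algebraMap F K (g i) * y ^ (M - (i + 1)) * (y * h) ^ ((i : ℕ) + 1) := by
      have e : y ^ M = y ^ (M - (i + 1)) * y ^ ((i : ℕ) + 1) := by
        rw [← pow_add]; congr 1; omega
      rw [e, mul_pow]
      ring
    rw [this]
    exact mul_mem (mul_mem (Subalgebra.algebraMap_mem _ _) (pow_mem (self_mem_coRing y) _))
      (pow_mem hyh _)
  have hGO : ∀ g O, Dominates F y O → O ≠ O₀ → G g ∈ O := fun g O hd hne =>
    sum_mem fun i _ => mul_mem (hd.1 _) (pow_mem (hO O hd hne) _)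
  have hBO : ∀ f (O : ValuationSubring K), (∀ c : F, algebraMap F K c ∈ O) → y⁻¹ ∈ O →
      B f ∈ O := fun f O hF hy =>
    sum_mem fun j _ => mul_mem (sum_mem fun i _ => mul_mem (hF _) (pow_mem hy _)) (hbO j O hF hy)
  -- More than `q` pairs share a polar part. The excess over `q` is used below, where differences
  -- are known only to be constants and two equal constants are needed.
  obtain ⟨t, -, ht⟩ := Finset.exists_lt_card_fiber_of_mul_lt_card_of_maps_to
    (s := (Finset.univ : Finset ((Fin N → Fin n → F) × (Fin M → F))))
    (t := (Finset.univ : Finset (Fin M → coRing F y ⧸ coIdeal F y)))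
    (f := fun p => τ (B p.1 + G p.2)) (n := Fintype.card F) (fun _ _ => Finset.mem_univ _) (by
      rw [Finset.card_univ, Finset.card_univ, Fintype.card_prod, Fintype.card_fun, Fintype.card_fun,
        Fintype.card_fun, Fintype.card_fun]
      simp only [Fintype.card_fin]
      rw [Nat.card_eq_fintype_card, Nat.card_eq_fintype_card] at hcard
      calc Fintype.card (coRing F y ⧸ coIdeal F y) ^ M * Fintype.card F
          ≤ (Fintype.card F ^ N) ^ M * Fintype.card F := by gcongr
        _ = Fintype.card F ^ (N * M + 1) := by rw [← pow_mul, pow_succ]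
        _ < Fintype.card F ^ (n * N + M) := by
          refine Nat.pow_lt_pow_right Fintype.one_lt_card ?_
          rw [hM, Nat.mul_add, Nat.mul_comm n N, hn]
          omega
        _ = _ := by rw [← pow_mul, ← pow_add])
  set S := Finset.univ.filter fun p : (Fin N → Fin n → F) × (Fin M → F) => τ (B p.1 + G p.2) = t
    with hS
  obtain ⟨p₀, hp₀⟩ : S.Nonempty := Finset.card_pos.mp (by omega)
  have hdiff : ∀ p ∈ S, ∀ p' ∈ S, (B p.1 - B p'.1) + (G p.2 - G p'.2) ∈ coRing F y := by
    intro p hp p' hp'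
    have h1 := hτ (B p.1 + G p.2) (B p'.1 + G p'.2)
      (by rw [mul_add]; exact add_mem (hBM _) (hGM _))
      (by rw [mul_add]; exact add_mem (hBM _) (hGM _))
      ((Finset.mem_filter.mp hp).2.trans (Finset.mem_filter.mp hp').2.symm)
    convert h1 using 1
    ring
  have hreg : ∀ p ∈ S, ∀ O : ValuationSubring K, (∀ c : F, algebraMap F K c ∈ O) → O ≠ O₀ →
      B p.1 - B p₀.1 ∈ O := by
    intro p hp O hF hne
    by_cases hyO : y⁻¹ ∈ O
    · exact sub_mem (hBO _ O hF hyO) (hBO _ O hF hyO)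
    · have hd : Dominates F y O := by
        refine ⟨hF, ?_⟩
        rw [mem_iff_val, map_inv₀, not_le] at hyO
        exact (one_lt_inv_iff₀.mp hyO).2
      have h1 := hdiff p hp p₀ hp₀ O hd
      have h2 := sub_mem h1 (sub_mem (hGO p.2 O hd hne) (hGO p₀.2 O hd hne))
      simpa using h2
  have hcst : ∀ p ∈ S, ∃ c : F, algebraMap F K c = B p.1 - B p₀.1 := by
    intro p hp
    refine hconst _ fun O hF => ?_
    -- A pole at `O₀` would make the difference a function with that single pole, which is assumed
    -- not to exist. So it is regular everywhere, hence constant.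
    by_cases hne : O = O₀
    · by_contra hnot
      rw [hne] at hnot
      obtain ⟨O', hF', hne', hO'⟩ := hcontra _ hnot
      exact hO' (hreg p hp O' hF' hne')
    · exact hreg p hp O hF hne
  choose! w hw using hcst
  obtain ⟨p, hp, p', hp', hne, hww⟩ := Finset.exists_ne_map_eq_of_card_lt_of_maps_to
    (t := (Finset.univ : Finset F)) (by rwa [Finset.card_univ]) (f := w)
    (fun _ _ => Finset.mem_univ _)
  have hBB : B p.1 = B p'.1 := by
    have h1 := hw p hp
    rw [hww, hw p' hp'] at h1
    exact (sub_left_inj.mp h1).symm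
  have hf : p.1 = p'.1 := by
    rw [← sub_eq_zero, hBsub] at hBB
    exact sub_eq_zero.mp (hB0 _ hBB)
  -- A nonzero polynomial in `h` without constant term has a pole at `O₀`, so the `G` parts agree as
  -- well and the two pairs coincide.
  have hg : p.2 = p'.2 := by
    have h1 := hdiff p hp p' hp' O₀ h₀
    rw [hBB, sub_self, zero_add, hGsub] at h1
    exact sub_eq_zero.mp (hG0 _ h1)
  exact hne (Prod.ext hf hg)

end Valuations

/-! ### The structure of the base ring -/

/-- The intersection of the valuation rings containing `F` is the integral closure of `F` in `K`,
which is `F` by hypothesis. -/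
theorem algebraMap_of_mem_all {F K : Type*} [Field F] [Field K] [Algebra F K]
    (hconst : ∀ x : K, IsAlgebraic F x → x ∈ (algebraMap F K).range) (f : K)
    (hf : ∀ O : ValuationSubring K, (∀ c : F, algebraMap F K c ∈ O) → f ∈ O) :
    ∃ c : F, algebraMap F K c = f := by
  refine hconst f (IsIntegral.isAlgebraic ?_)
  have h1 : f ∈ (integralClosure (Subring.closure (Set.range (algebraMap F K))) K).toSubring := by
    rw [← iInf_valuationSubring_superset, Subring.mem_iInf]
    rintro ⟨O, hO⟩
    exact hf O fun c => hO ⟨c, rfl⟩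
  rw [show Set.range (algebraMap F K) = ((⊥ : Subalgebra F K).toSubring : Set K) from
    Algebra.coe_bot.symm, Subring.closure_eq] at h1
  have h2 : IsIntegral (⊥ : Subalgebra F K) f := h1
  have : Algebra.IsIntegral F (⊥ : Subalgebra F K) :=
    Algebra.IsIntegral.of_surjective (Algebra.ofId F (⊥ : Subalgebra F K)) (by
      rintro ⟨x, hx⟩
      obtain ⟨c, rfl⟩ := Algebra.mem_bot.mp hx
      exact ⟨c, rfl⟩)
  exact isIntegral_trans f h2

open IntermediateField in
theorem finiteDimensional_adjoin {F K : Type*} [Field F] [Field K] [Algebra F K]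
    [Algebra (RatFunc F) K] [IsScalarTower F (RatFunc F) K] [FunctionField F K] {y : K}
    (hy : algebraMap (RatFunc F) K RatFunc.X ∈ F⟮y⟯) : FiniteDimensional F⟮y⟯ K := by
  have hmem : ∀ r : RatFunc F, algebraMap (RatFunc F) K r ∈ F⟮y⟯ := by
    have h1 : (⊤ : IntermediateField F (RatFunc F)) ≤
        F⟮y⟯.comap (IsScalarTower.toAlgHom F (RatFunc F) K) := by
      rw [← RatFunc.adjoin_X, adjoin_simple_le_iff]
      exact hy
    exact fun r => h1 (mem_top (x := r))
  let j : RatFunc F →+* F⟮y⟯ := (algebraMap (RatFunc F) K).codRestrict F⟮y⟯ hmem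
  let _ : Algebra (RatFunc F) F⟮y⟯ := j.toAlgebra
  have : IsScalarTower (RatFunc F) F⟮y⟯ K := IsScalarTower.of_algebraMap_eq fun _ => rfl
  exact Module.Finite.of_restrictScalars_finite (RatFunc F) F⟮y⟯ K

namespace Place

variable {F K : Type*} [Field F] [Field K] [Algebra F K] {P : Place F K}

theorem val_const_le_one (c : F) : P.val (algebraMap F K c) ≤ 1 := by
  by_cases hc : c = 0
  · simp [hc]
  · exact (P.trivial_on_constants c hc).le

theorem valuationSubring_lt_one_iff {x : K} :
    P.val.valuationSubring.valuation x < 1 ↔ P.val x < 1 :=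
  (Valuation.isEquiv_valuation_valuationSubring P.val).symm.lt_one_iff_lt_one

variable (P) in
/-- The properties of the base ring of a rational place of a function field that are used
below. -/
structure IsStandard : Prop where
  rational : P.IsRational
  const : ∀ a : P.baseRing, P.val (a : K) ≤ 1 → ∃ c : F, algebraMap F P.baseRing c = a
  exists_pole : ∃ f : P.baseRing, 1 < P.val (f : K)

open IntermediateField in
theorem isStandard [Finite F] [Algebra (RatFunc F) K] [IsScalarTower F (RatFunc F) K]
    [FunctionField F K]
    (hconst : ∀ x : K, IsAlgebraic F x → x ∈ (algebraMap F K).range) (hP : P.IsRational) :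
    P.IsStandard := by
  refine ⟨hP, fun a ha => ?_, ?_⟩
  · obtain ⟨c, hc⟩ := algebraMap_of_mem_all hconst (a : K) fun O hO => by
      by_cases h : O = P.val.valuationSubring
      · rw [h]; exact ha
      · exact a.2 O hO h
    exact ⟨c, Subtype.ext hc⟩
  · set O₀ := P.val.valuationSubring with hO₀
    have hF : ∀ c : F, algebraMap F K c ∈ O₀ := val_const_le_one
    have hr : ∀ x ∈ O₀, ∃ c : F, O₀.valuation (x - algebraMap F K c) < 1 := fun x hx => by
      obtain ⟨c, hc⟩ := hP x hx
      exact ⟨c, valuationSubring_lt_one_iff.mpr hc⟩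
    set t : K := algebraMap (RatFunc F) K RatFunc.X with ht
    -- A generator of the rational subfield that vanishes at the place: `t - c` if `t` has residue
    -- `c` there, and `t⁻¹` if `t` has a pole.
    obtain ⟨y, hy0, hyv, hty⟩ : ∃ y : K, y ≠ 0 ∧ O₀.valuation y < 1 ∧ t ∈ F⟮y⟯ := by
      by_cases htO : t ∈ O₀
      · obtain ⟨c, hc⟩ := hr t htO
        refine ⟨t - algebraMap F K c, ?_, hc, ?_⟩
        · rw [sub_ne_zero, ht, IsScalarTower.algebraMap_apply F (RatFunc F) K]
          intro h
          have h1 := (algebraMap (RatFunc F) K).injective h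
          rw [← RatFunc.algebraMap_X, IsScalarTower.algebraMap_apply F (Polynomial F) (RatFunc F)]
            at h1
          exact Polynomial.X_ne_C c (RatFunc.algebraMap_injective F h1)
        · have := add_mem (mem_adjoin_simple_self F (t - algebraMap F K c))
            (F⟮t - algebraMap F K c⟯.algebraMap_mem c)
          simpa using this
      · have ht0 : t ≠ 0 := by rintro h; rw [h] at htO; exact htO O₀.zero_mem
        refine ⟨t⁻¹, inv_ne_zero ht0, ?_, ?_⟩
        · rw [map_inv₀]
          rw [mem_iff_val, not_le] at htO
          exact inv_lt_one_of_one_lt₀ htO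
        · rw [adjoin_inv_eq]
          exact mem_adjoin_simple_self F t
    have := finiteDimensional_adjoin hty
    obtain ⟨f, hf, hfO⟩ := exists_single_pole hy0 ⟨hF, hyv⟩ hr (algebraMap_of_mem_all hconst)
    refine ⟨⟨f, hfO⟩, ?_⟩
    exact not_le.mp hf

theorem IsStandard.exists_val_eq_exp (h : P.IsStandard) {a : P.baseRing} (ha : a ≠ 0) :
    ∃ n : ℕ, P.val (a : K) = WithZero.exp (n : ℤ) := by
  have ha' : (a : K) ≠ 0 := by simpa using ha
  have hv : P.val (a : K) ≠ 0 := by simpa using ha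
  have h1 : 1 ≤ P.val (a : K) := by
    by_contra hlt
    rw [not_le] at hlt
    obtain ⟨c, rfl⟩ := h.const a hlt.le
    have hc : c ≠ 0 := by rintro rfl; simp at ha
    have := P.trivial_on_constants c hc
    exact absurd hlt (by simp [this])
  refine ⟨(WithZero.log (P.val (a : K))).toNat, ?_⟩
  rw [Int.toNat_of_nonneg, WithZero.exp_log hv]
  rw [← WithZero.exp_le_exp, WithZero.exp_log hv]
  exact h1

theorem deg_eq_of_val {x : K} {n : ℤ} (h : P.val x = WithZero.exp n) : P.deg x = n := by
  rw [deg, h, WithZero.log_exp]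

theorem val_of_deg {x : K} (hx : x ≠ 0) : P.val x = WithZero.exp (P.deg x) := by
  rw [deg, WithZero.exp_log]; simpa using hx

variable (P) in
/-- The elements of the base ring of degree less than `d`. -/
def degreeLT (d : ℕ) : Submodule F P.baseRing where
  carrier := {a | P.val (a : K) < WithZero.exp (d : ℤ)}
  zero_mem' := by simp
  add_mem' ha hb := P.val.map_add_lt ha hb
  smul_mem' c a ha := by
    change P.val ((c • a : P.baseRing) : K) < _
    rw [show ((c • a : P.baseRing) : K) = algebraMap F K c * a from Algebra.smul_def _ _, map_mul]
    exact (mul_le_of_le_one_left' (val_const_le_one c)).trans_lt ha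

theorem mem_degreeLT {d : ℕ} {a : P.baseRing} :
    a ∈ P.degreeLT d ↔ P.val (a : K) < WithZero.exp (d : ℤ) := Iff.rfl

theorem degreeLT_mono {d e : ℕ} (h : d ≤ e) : P.degreeLT d ≤ P.degreeLT e := fun a ha =>
  lt_of_lt_of_le (mem_degreeLT.mp ha) (WithZero.exp_le_exp.mpr (by omega))

theorem mem_degreeLT_succ {d : ℕ} {a : P.baseRing} :
    a ∈ P.degreeLT (d + 1) ↔ P.val (a : K) ≤ WithZero.exp (d : ℤ) := by
  rw [mem_degreeLT]
  by_cases h : P.val (a : K) = 0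
  · simp [h]
  · rw [← WithZero.log_lt_iff_lt_exp h, ← WithZero.log_le_iff_le_exp h]
    push_cast
    omega

theorem val_smul {c : F} (hc : c ≠ 0) (a : P.baseRing) :
    P.val ((c • a : P.baseRing) : K) = P.val (a : K) := by
  rw [show ((c • a : P.baseRing) : K) = algebraMap F K c * a from Algebra.smul_def _ _, map_mul,
    P.trivial_on_constants c hc, one_mul]

theorem val_add_of_mem_degreeLT {d : ℕ} {a₀ : P.baseRing}
    (ha₀ : P.val (a₀ : K) = WithZero.exp (d : ℤ)) {v : P.baseRing} (hv : v ∈ P.degreeLT d) :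
    P.val ((a₀ + v : P.baseRing) : K) = WithZero.exp (d : ℤ) := by
  rw [← ha₀]
  exact Valuation.map_add_eq_of_lt_left _ (by rw [ha₀]; exact hv)

theorem smul_add_mem {d : ℕ} {a₀ : P.baseRing} (ha₀ : P.val (a₀ : K) = WithZero.exp (d : ℤ))
    (c : F) (v : P.degreeLT d) : c • a₀ + v ∈ P.degreeLT (d + 1) :=
  add_mem (Submodule.smul_mem _ c (mem_degreeLT_succ.mpr ha₀.le))
    (degreeLT_mono (Nat.le_succ d) v.2)

/-- Rationality of the place: the leading coefficient relative to `a₀` lies in `F`, so one step in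
degree adds at most one dimension. -/
theorem smul_add_bijective (hP : P.IsRational) {d : ℕ} {a₀ : P.baseRing}
    (ha₀ : P.val (a₀ : K) = WithZero.exp (d : ℤ)) :
    Function.Bijective fun p : F × P.degreeLT d =>
      (⟨p.1 • a₀ + p.2, smul_add_mem ha₀ p.1 p.2⟩ : P.degreeLT (d + 1)) := by
  have ha0 : (a₀ : K) ≠ 0 := by
    intro h; rw [h, map_zero] at ha₀; exact WithZero.exp_ne_zero ha₀.symm
  constructor
  · rintro ⟨c, v⟩ ⟨c', v'⟩ h
    have h1 : c • a₀ + v = c' • a₀ + v' := congrArg Subtype.val h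
    have hc : c = c' := by
      by_contra hne
      have h2 : (c - c') • a₀ = ((v' - v : P.degreeLT d) : P.baseRing) := by
        rw [sub_smul, AddSubgroupClass.coe_sub]
        linear_combination h1
      have h3 := (v' - v).2
      rw [← h2, mem_degreeLT, val_smul (sub_ne_zero.mpr hne), ha₀] at h3
      exact lt_irrefl _ h3
    subst hc
    simpa using h1
  · rintro ⟨u, hu⟩
    obtain ⟨c, hc⟩ := hP ((u : K) / a₀) (by
      rw [map_div₀, ha₀]
      exact div_le_one_of_le₀ (mem_degreeLT_succ.mp hu) zero_le)
    have hv : u - c • a₀ ∈ P.degreeLT d := by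
      rw [mem_degreeLT, ← ha₀]
      have : ((u - c • a₀ : P.baseRing) : K) = (u / a₀ - algebraMap F K c) * a₀ := by
        rw [sub_mul, div_mul_cancel₀ _ ha0]
        simp [Algebra.smul_def]
      rw [this, map_mul]
      exact mul_lt_of_lt_one_left (by rw [ha₀]; exact WithZero.exp_pos) hc
    exact ⟨(c, ⟨_, hv⟩), Subtype.ext (by simp)⟩

theorem degreeLT_succ_eq {d : ℕ}
    (hd : ∀ a : P.baseRing, P.val (a : K) ≠ WithZero.exp (d : ℤ)) :
    P.degreeLT (d + 1) = P.degreeLT d := by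
  refine le_antisymm (fun a ha => ?_) (degreeLT_mono (Nat.le_succ d))
  exact lt_of_le_of_ne (mem_degreeLT_succ.mp ha) (hd a)

theorem degreeLT_zero (h : P.IsStandard) : P.degreeLT 0 = ⊥ := by
  rw [eq_bot_iff]
  intro a ha
  by_contra hne
  obtain ⟨n, hn⟩ := h.exists_val_eq_exp hne
  rw [mem_degreeLT, hn, WithZero.exp_lt_exp] at ha
  omega

theorem finite_degreeLT [Finite F] (h : P.IsStandard) (d : ℕ) : Finite (P.degreeLT d) := by
  induction d with
  | zero => rw [degreeLT_zero h]; infer_instance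
  | succ d ih =>
    by_cases hd : ∃ a : P.baseRing, P.val (a : K) = WithZero.exp (d : ℤ)
    · obtain ⟨a, ha⟩ := hd
      exact Finite.of_surjective _ (smul_add_bijective h.rational ha).surjective
    · push Not at hd
      rw [degreeLT_succ_eq hd]
      exact ih

theorem sum_degreeLT_succ [Fintype F] (hP : P.IsRational) {d : ℕ} [Fintype (P.degreeLT d)]
    [Fintype (P.degreeLT (d + 1))] {a₀ : P.baseRing}
    (ha₀ : P.val (a₀ : K) = WithZero.exp (d : ℤ)) {M : Type*} [AddCommMonoid M]
    (f : P.baseRing → M) :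
    ∑ u : P.degreeLT (d + 1), f u = ∑ c : F, ∑ v : P.degreeLT d, f (c • a₀ + v) := by
  rw [← Fintype.sum_prod_type']
  exact ((smul_add_bijective hP ha₀).sum_comp fun u : P.degreeLT (d + 1) => f u).symm

theorem card_degreeLT_succ [Fintype F] (hP : P.IsRational) {d : ℕ} [Fintype (P.degreeLT d)]
    [Fintype (P.degreeLT (d + 1))] {a₀ : P.baseRing}
    (ha₀ : P.val (a₀ : K) = WithZero.exp (d : ℤ)) :
    Fintype.card (P.degreeLT (d + 1)) = Fintype.card F * Fintype.card (P.degreeLT d) := by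
  rw [← Fintype.card_prod]
  exact (Fintype.card_of_bijective (smul_add_bijective hP ha₀)).symm

/-- The dimension of the space of elements of degree less than `d` grows at least linearly. -/
theorem exists_card_degreeLT_ge [Fintype F] (h : P.IsStandard) :
    ∃ e : ℕ, 0 < e ∧ ∀ d k : ℕ, e * k ≤ d → ∀ [Fintype (P.degreeLT d)],
      Fintype.card F ^ k ≤ Fintype.card (P.degreeLT d) := by
  obtain ⟨f, hf⟩ := h.exists_pole
  have hf0 : f ≠ 0 := by rintro rfl; simp at hf
  obtain ⟨e, he⟩ := h.exists_val_eq_exp hf0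
  have he0 : 0 < e := by
    rw [he, ← WithZero.exp_zero, WithZero.exp_lt_exp] at hf; omega
  -- With `e` the degree of a nonconstant `f`, the powers `1, f, …, f ^ (k - 1)` are independent and
  -- of degree less than `e * k ≤ d`.
  refine ⟨e, he0, fun d k hk _ => ?_⟩
  have hmem : ∀ a : Fin k → F, ∑ i, a i • f ^ (i : ℕ) ∈ P.degreeLT d := fun a =>
    Submodule.sum_mem _ fun i _ => Submodule.smul_mem _ _ (by
      rw [mem_degreeLT, SubmonoidClass.coe_pow, map_pow, he, ← WithZero.exp_nsmul,
        WithZero.exp_lt_exp]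
      have h1 : e * (i : ℕ) < e * k := Nat.mul_lt_mul_of_pos_left i.2 he0
      rw [nsmul_eq_mul]
      push_cast [mul_comm]
      zify at h1 hk
      linarith)
  have hinj : Function.Injective fun a : Fin k → F => (⟨_, hmem a⟩ : P.degreeLT d) := by
    intro a b hab
    have h1 : ∑ i, a i • f ^ (i : ℕ) = ∑ i, b i • f ^ (i : ℕ) := congrArg Subtype.val hab
    set p : Polynomial F := ∑ i : Fin k, Polynomial.C (a i - b i) * Polynomial.X ^ (i : ℕ) with hp
    have hpe : Polynomial.aeval (f : K) p = 0 := by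
      have h2 : Polynomial.aeval f p = 0 := by
        simp [hp, sub_mul, Finset.sum_sub_distrib, ← Algebra.smul_def, h1]
      have h3 := congrArg P.baseRing.val h2
      rwa [← Polynomial.aeval_algHom_apply, map_zero] at h3
    have hp0 : p = 0 := by
      by_contra hp0
      have := val_aeval_of_one_lt P.val val_const_le_one hf hp0
      rw [hpe, map_zero] at this
      exact pow_ne_zero _ (zero_lt_one.trans hf).ne' this.symm
    ext i
    have hi := congrArg (fun r => Polynomial.coeff r (i : ℕ)) hp0
    simp only [hp, Polynomial.finsetSum_coeff, Polynomial.coeff_C_mul, Polynomial.coeff_X_pow,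
      Polynomial.coeff_zero] at hi
    rw [Finset.sum_eq_single i] at hi
    · simpa [sub_eq_zero] using hi
    · intro k _ hk
      rw [if_neg (fun e => hk (Fin.ext e.symm)), mul_zero]
    · simp
  simpa using Fintype.card_le_of_injective _ hinj

/-- The base ring has a basis of strictly increasing degrees. -/
theorem exists_basis (h : P.IsStandard) :
    ∃ β : Module.Basis ℕ F P.baseRing, StrictMono fun i => P.deg (β i : K) := by
  classical
  -- One basis vector for each degree that occurs. Distinct degrees give independence, and
  -- subtraction of leading terms gives spanning.
  set D : Set ℕ := {d | ∃ a : P.baseRing, P.val (a : K) = WithZero.exp (d : ℤ)} with hD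
  have hinf : D.Infinite := by
    obtain ⟨f, hf⟩ := h.exists_pole
    have hf0 : f ≠ 0 := by rintro rfl; simp at hf
    obtain ⟨e, he⟩ := h.exists_val_eq_exp hf0
    have he0 : 0 < e := by
      rw [he, ← WithZero.exp_zero, WithZero.exp_lt_exp] at hf; omega
    refine Set.infinite_of_injective_forall_mem (f := fun n : ℕ => n * e)
      (fun a b hab => Nat.eq_of_mul_eq_mul_right he0 hab) fun n => ⟨f ^ n, ?_⟩
    rw [SubmonoidClass.coe_pow, map_pow, he, ← WithZero.exp_nsmul, nsmul_eq_mul]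
    push_cast
    rfl
  have hn : ∀ i, Nat.nth (· ∈ D) i ∈ D := fun i => Nat.nth_mem_of_infinite hinf i
  choose β hβ using hn
  have hmono : StrictMono (Nat.nth (· ∈ D)) := Nat.nth_strictMono hinf
  have hli : LinearIndependent F β := by
    rw [linearIndependent_iff']
    intro s g hg
    by_contra! hne
    obtain ⟨i₀, hi₀, hgi₀⟩ := hne
    set s' := s.filter fun i => g i ≠ 0 with hs'
    have hs'ne : s'.Nonempty := ⟨i₀, Finset.mem_filter.mpr ⟨hi₀, hgi₀⟩⟩
    set m := s'.max' hs'ne with hm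
    have hms : m ∈ s' := s'.max'_mem hs'ne
    have h1 : ∑ i ∈ s', g i • β i = 0 := by
      rw [← hg]
      refine Finset.sum_filter_of_ne fun i _ hi => ?_
      rintro h0; exact hi (by rw [h0, zero_smul])
    rw [← Finset.add_sum_erase _ _ hms] at h1
    have h2 : ∑ i ∈ s'.erase m, g i • β i ∈ P.degreeLT (Nat.nth (· ∈ D) m) := by
      refine Submodule.sum_mem _ fun i hi => Submodule.smul_mem _ _ ?_
      rw [mem_degreeLT, hβ, WithZero.exp_lt_exp]
      have hlt : i < m := lt_of_le_of_ne (s'.le_max' i (Finset.mem_of_mem_erase hi))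
        (Finset.ne_of_mem_erase hi)
      exact_mod_cast hmono hlt
    have h3 : g m • β m ∈ P.degreeLT (Nat.nth (· ∈ D) m) := by
      rw [eq_neg_of_add_eq_zero_left h1]
      exact neg_mem h2
    rw [mem_degreeLT, val_smul (Finset.mem_filter.mp hms).2, hβ] at h3
    exact lt_irrefl _ h3
  have hspan : ∀ d, P.degreeLT d ≤ Submodule.span F (Set.range β) := by
    intro d
    induction d with
    | zero => rw [degreeLT_zero h]; exact bot_le
    | succ d ih =>
      intro a ha
      by_cases hd : d ∈ D
      · obtain ⟨i, hi⟩ : ∃ i, Nat.nth (· ∈ D) i = d := by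
          have := Nat.range_nth_of_infinite hinf
          exact (Set.ext_iff.mp this d).mpr hd
        have hβi : P.val (β i : K) = WithZero.exp (d : ℤ) := by rw [hβ, hi]
        obtain ⟨⟨c, v⟩, hcv⟩ := (smul_add_bijective h.rational hβi).surjective ⟨a, ha⟩
        have h1 : c • β i + v = a := congrArg Subtype.val hcv
        rw [← h1]
        exact add_mem (Submodule.smul_mem _ _ (Submodule.subset_span ⟨i, rfl⟩)) (ih v.2)
      · refine ih ?_
        rw [← degreeLT_succ_eq (d := d) fun a ha => hd ⟨a, ha⟩]
        exact ha
  refine ⟨Module.Basis.mk hli fun a _ => ?_, fun i j hij => ?_⟩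
  · by_cases ha : a = 0
    · rw [ha]; exact zero_mem _
    · obtain ⟨n, hn⟩ := h.exists_val_eq_exp ha
      exact hspan (n + 1) (mem_degreeLT_succ.mpr hn.le)
  · simp only [Module.Basis.mk_apply]
    rw [deg_eq_of_val (hβ i), deg_eq_of_val (hβ j)]
    exact_mod_cast hmono hij

/-- Distinct degrees exclude cancellation, so the degree of `a` is that of the last basis vector in
its expansion. -/
theorem deg_basis_lt_of_repr_ne_zero {β : Module.Basis ℕ F P.baseRing}
    (hβ : StrictMono fun i => P.deg (β i : K)) (d : ℕ) (a : P.baseRing) (ha : a ∈ P.degreeLT d)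
    (i : ℕ) (hi : β.repr a i ≠ 0) : P.deg (β i : K) < d := by
  classical
  have hβ0 : ∀ i, ((β i : P.baseRing) : K) ≠ 0 := fun i => by simpa using β.ne_zero i
  have hs : (β.repr a).support.Nonempty := ⟨i, Finsupp.mem_support_iff.mpr hi⟩
  set m := (β.repr a).support.max' hs with hm
  have hms : m ∈ (β.repr a).support := (β.repr a).support.max'_mem hs
  have h1 : a = (β.repr a m) • β m + ∑ j ∈ (β.repr a).support.erase m, β.repr a j • β j := by
    rw [Finset.add_sum_erase _ (fun j => β.repr a j • β j) hms]
    exact (β.linearCombination_repr a).symm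
  have h2 : P.val ((β.repr a m • β m : P.baseRing) : K) = WithZero.exp (P.deg (β m : K)) := by
    rw [val_smul (Finsupp.mem_support_iff.mp hms), val_of_deg (hβ0 m)]
  have h3 : P.val ((∑ j ∈ (β.repr a).support.erase m, β.repr a j • β j : P.baseRing) : K) <
      WithZero.exp (P.deg (β m : K)) := by
    rw [show ((∑ j ∈ (β.repr a).support.erase m, β.repr a j • β j : P.baseRing) : K) =
      ∑ j ∈ (β.repr a).support.erase m, ((β.repr a j • β j : P.baseRing) : K) by simp]
    refine P.val.map_sum_lt WithZero.exp_ne_zero fun j hj => ?_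
    have hj' := Finset.mem_of_mem_erase hj
    rw [val_smul (Finsupp.mem_support_iff.mp hj'), val_of_deg (hβ0 j), WithZero.exp_lt_exp]
    exact hβ (lt_of_le_of_ne (Finset.le_max' _ j hj') (Finset.ne_of_mem_erase hj))
  have h4 : P.val (a : K) = WithZero.exp (P.deg (β m : K)) := by
    conv_lhs => rw [h1]
    rw [← h2]
    exact Valuation.map_add_eq_of_lt_left _ (by rw [h2]; exact h3)
  rw [mem_degreeLT, h4, WithZero.exp_lt_exp] at ha
  exact lt_of_le_of_lt (hβ.monotone (Finset.le_max' _ i (Finsupp.mem_support_iff.mpr hi))) ha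

end Place

/-! ### Absolute values, signs and power sums -/

namespace Place

variable {F K : Type*} [Field F] [Field K] [Algebra F K] {P : Place F K} [Fintype F]

theorem absVal_of_val {x : K} {n : ℤ} (h : P.val x = WithZero.exp n) :
    P.absVal x = (P.q : ℝ) ^ n := by
  have h1 : P.absVal x = WithZeroMulInt.toNNReal P.one_lt_q.ne_zero (P.val x) := rfl
  rw [h1, h, WithZeroMulInt.toNNReal_neg_apply _ WithZero.exp_ne_zero]
  push_cast
  rfl

theorem absVal_lt_iff {x y : K} : P.absVal x < P.absVal y ↔ P.val x < P.val y :=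
  (NNReal.coe_lt_coe).trans (WithZeroMulInt.toNNReal_strictMono P.one_lt_q).lt_iff_lt

theorem absVal_le_iff {x y : K} : P.absVal x ≤ P.absVal y ↔ P.val x ≤ P.val y :=
  (NNReal.coe_le_coe).trans (WithZeroMulInt.toNNReal_strictMono P.one_lt_q).le_iff_le

theorem absVal_lt_one_iff {x : K} : P.absVal x < 1 ↔ P.val x < 1 := by
  rw [← map_one P.absVal, absVal_lt_iff, map_one]

theorem absVal_le_one_iff {x : K} : P.absVal x ≤ 1 ↔ P.val x ≤ 1 := by
  rw [← map_one P.absVal, absVal_le_iff, map_one]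

theorem absVal_const {c : F} (hc : c ≠ 0) : P.absVal (algebraMap F K c) = 1 := by
  rw [absVal_of_val (n := 0), zpow_zero]
  rw [P.trivial_on_constants c hc, WithZero.exp_zero]

theorem isNonarchimedean_absVal : IsNonarchimedean P.absVal := P.absVal_add_le_max

theorem one_lt_q_real : (1 : ℝ) < P.q := by exact_mod_cast P.one_lt_q

theorem q_pos : (0 : ℝ) < P.q := zero_lt_one.trans one_lt_q_real

variable {π : P.KInf}

theorem norm_zpow_eq_one_iff (hπ : P.IsUniformizer π) {n : ℤ} : ‖π‖ ^ n = 1 ↔ n = 0 := by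
  rw [show ‖π‖ = (P.q : ℝ)⁻¹ from hπ, inv_zpow, inv_eq_one,
    zpow_eq_one_iff_right₀ q_pos.le one_lt_q_real.ne']

theorem uniformizer_ne_zero (hπ : P.IsUniformizer π) : π ≠ 0 := by
  rw [← norm_ne_zero_iff, show ‖π‖ = (P.q : ℝ)⁻¹ from hπ]
  exact inv_ne_zero q_pos.ne'

theorem norm_const {c : F} (hc : c ≠ 0) : ‖algebraMap K P.KInf (algebraMap F K c)‖ = 1 := by
  rw [norm_toKInf, absVal_const hc]

theorem norm_eq_one_of_norm_sub_lt {x y : P.KInf} (h : ‖x - y‖ < 1) (hy : ‖y‖ = 1) : ‖x‖ = 1 := by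
  have := IsUltrametricDist.norm_add_eq_max_of_norm_ne_norm (x := x - y) (y := y)
    (by rw [hy]; exact h.ne)
  rw [sub_add_cancel, hy, max_eq_right h.le] at this
  exact this

/-- Makes the choice in `sgn` immaterial. -/
theorem sign_unique (hπ : P.IsUniformizer π) {x : P.KInf} {c c' : F} (hc : c ≠ 0) (hc' : c' ≠ 0)
    {n m : ℤ} (h : ‖x * π ^ (-n) - algebraMap K P.KInf (algebraMap F K c)‖ < 1)
    (h' : ‖x * π ^ (-m) - algebraMap K P.KInf (algebraMap F K c')‖ < 1) : c = c' ∧ n = m := by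
  have hπ0 := uniformizer_ne_zero hπ
  have h1 := norm_eq_one_of_norm_sub_lt h (norm_const hc)
  have h2 := norm_eq_one_of_norm_sub_lt h' (norm_const hc')
  have hnm : n = m := by
    have h3 : x * π ^ (-m) = x * π ^ (-n) * π ^ (n - m) := by
      rw [mul_assoc, ← zpow_add₀ hπ0]; congr 2; ring
    rw [h3, norm_mul, h1, one_mul, norm_zpow, norm_zpow_eq_one_iff hπ] at h2
    omega
  subst hnm
  refine ⟨?_, rfl⟩
  by_contra hne
  have h3 : ‖algebraMap K P.KInf (algebraMap F K (c - c'))‖ < 1 := by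
    have e : algebraMap K P.KInf (algebraMap F K (c - c')) =
      (x * π ^ (-n) - algebraMap K P.KInf (algebraMap F K c')) +
        -(x * π ^ (-n) - algebraMap K P.KInf (algebraMap F K c)) := by
      rw [map_sub, map_sub]; ring
    rw [e]
    refine (IsUltrametricDist.norm_add_le_max _ _).trans_lt (max_lt h' ?_)
    rwa [norm_neg]
  rw [norm_const (sub_ne_zero.mpr hne)] at h3
  exact lt_irrefl _ h3

theorem sgn_eq_one_iff (hπ : P.IsUniformizer π) {x : P.KInf} :
    sgn π x = 1 ↔ ∃ n : ℤ, ‖x * π ^ (-n) - 1‖ < 1 := by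
  constructor
  · intro h
    unfold sgn at h
    split_ifs at h with hx
    · obtain ⟨hc, n, hn⟩ := hx.choose_spec
      rw [h, map_one, map_one] at hn
      exact ⟨n, hn⟩
    · exact absurd h zero_ne_one
  · rintro ⟨n, hn⟩
    have hx : ∃ c : F, c ≠ 0 ∧
        ∃ n : ℤ, ‖x * π ^ (-n) - algebraMap K P.KInf (algebraMap F K c)‖ < 1 :=
      ⟨1, one_ne_zero, n, by simpa using hn⟩
    rw [sgn, dif_pos hx]
    obtain ⟨hc, m, hm⟩ := hx.choose_spec
    exact (sign_unique hπ hc one_ne_zero hm (m := n) (by simpa using hn)).1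

theorem mem_monic_iff (hπ : P.IsUniformizer π) {d : ℕ} {a : P.baseRing} :
    a ∈ monic π d ↔ P.val (a : K) = WithZero.exp (d : ℤ) ∧
      ‖algebraMap K P.KInf (a : K) * π ^ d - 1‖ < 1 := by
  have hnorm : P.val (a : K) = WithZero.exp (d : ℤ) → ∀ n : ℤ,
      ‖algebraMap K P.KInf (a : K) * π ^ (-n) - 1‖ < 1 → n = -d := by
    intro ha n hn
    have h1 := norm_eq_one_of_norm_sub_lt hn norm_one
    rw [norm_mul, norm_toKInf, absVal_of_val ha, norm_zpow, show ‖π‖ = (P.q : ℝ)⁻¹ from hπ,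
      inv_zpow', neg_neg, ← zpow_add₀ q_pos.ne',
      zpow_eq_one_iff_right₀ q_pos.le one_lt_q_real.ne'] at h1
    omega
  constructor
  · rintro ⟨h1, h2⟩
    obtain ⟨n, hn⟩ := (sgn_eq_one_iff hπ).mp h1
    have ha0 : (a : K) ≠ 0 := by
      intro h
      rw [h, map_zero, zero_mul, zero_sub, norm_neg, norm_one] at hn
      exact lt_irrefl _ hn
    have hv : P.val (a : K) = WithZero.exp (d : ℤ) := by rw [val_of_deg ha0, h2]
    refine ⟨hv, ?_⟩
    rw [hnorm hv n hn, neg_neg, zpow_natCast] at hn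
    exact hn
  · rintro ⟨h1, h2⟩
    exact ⟨(sgn_eq_one_iff hπ).mpr ⟨-d, by simpa using h2⟩, deg_eq_of_val h1⟩

/-- Two elements of degree `d` have the same leading coefficient exactly when their difference has
smaller degree. Sums over monic elements thereby become sums over a coset. -/
theorem monic_eq (hπ : P.IsUniformizer π) {d : ℕ} {a₀ : P.baseRing} (ha₀ : a₀ ∈ monic π d) :
    monic π d = Set.range fun v : P.degreeLT d => a₀ + (v : P.baseRing) := by
  have hπ0 := uniformizer_ne_zero hπ
  rw [mem_monic_iff hπ] at ha₀
  have key : ∀ b : P.baseRing, ‖algebraMap K P.KInf (b : K) * π ^ d‖ < 1 ↔ b ∈ P.degreeLT d := by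
    intro b
    rw [mem_degreeLT, ← ha₀.1, ← absVal_lt_iff, norm_mul, norm_toKInf, norm_pow,
      show ‖π‖ = (P.q : ℝ)⁻¹ from hπ, absVal_of_val ha₀.1, inv_pow, ← div_eq_mul_inv,
      div_lt_one (pow_pos q_pos _), zpow_natCast]
  ext a
  rw [mem_monic_iff hπ]
  constructor
  · rintro ⟨h1, h2⟩
    refine ⟨⟨a - a₀, (key _).mp ?_⟩, by simp⟩
    have e : algebraMap K P.KInf ((a - a₀ : P.baseRing) : K) * π ^ d =
        (algebraMap K P.KInf (a : K) * π ^ d - 1) + -(algebraMap K P.KInf (a₀ : K) * π ^ d - 1) := by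
      rw [AddSubgroupClass.coe_sub, map_sub]; ring
    rw [e]
    refine (IsUltrametricDist.norm_add_le_max _ _).trans_lt (max_lt h2 ?_)
    rw [norm_neg]; exact ha₀.2
  · rintro ⟨v, rfl⟩
    refine ⟨val_add_of_mem_degreeLT ha₀.1 v.2, ?_⟩
    have e : algebraMap K P.KInf ((a₀ + v : P.baseRing) : K) * π ^ d - 1 =
        (algebraMap K P.KInf (a₀ : K) * π ^ d - 1) +
          algebraMap K P.KInf ((v : P.baseRing) : K) * π ^ d := by
      rw [AddMemClass.coe_add, map_add]; ring
    rw [e]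
    exact (IsUltrametricDist.norm_add_le_max _ _).trans_lt (max_lt ha₀.2 ((key _).mpr v.2))

/-- The leading coefficient in `K_∞` lies in `F`, by density of `K` and rationality of the place;
dividing by it makes `a` monic. -/
theorem exists_mem_monic (hP : P.IsRational) (hπ : P.IsUniformizer π) {d : ℕ} {a : P.baseRing}
    (ha : P.val (a : K) = WithZero.exp (d : ℤ)) : (monic π d).Nonempty := by
  set x := algebraMap K P.KInf (a : K) * π ^ d with hx
  have hx1 : ‖x‖ = 1 := by
    rw [hx, norm_mul, norm_toKInf, norm_pow, absVal_of_val ha, show ‖π‖ = (P.q : ℝ)⁻¹ from hπ,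
      zpow_natCast, inv_pow, mul_inv_cancel₀ (pow_ne_zero _ q_pos.ne')]
  obtain ⟨y, hy⟩ := P.denseRange_toKInf.exists_dist_lt x one_pos
  rw [dist_eq_norm] at hy
  have hy1 : ‖algebraMap K P.KInf y‖ = 1 :=
    norm_eq_one_of_norm_sub_lt (by rwa [norm_sub_rev]) hx1
  rw [norm_toKInf] at hy1
  obtain ⟨c, hc⟩ := hP y (absVal_le_one_iff.mp hy1.le)
  rw [← absVal_lt_one_iff, ← norm_toKInf, map_sub] at hc
  have hxc : ‖x - algebraMap K P.KInf (algebraMap F K c)‖ < 1 := by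
    rw [← sub_add_sub_cancel x (algebraMap K P.KInf y)]
    exact (IsUltrametricDist.norm_add_le_max _ _).trans_lt (max_lt hy hc)
  have hc0 : c ≠ 0 := by
    rintro rfl
    rw [map_zero, map_zero, sub_zero, hx1] at hxc
    exact lt_irrefl _ hxc
  refine ⟨c⁻¹ • a, (mem_monic_iff hπ).mpr ⟨by rw [val_smul (inv_ne_zero hc0), ha], ?_⟩⟩
  have hc' : algebraMap K P.KInf (algebraMap F K c) ≠ 0 := by simpa using hc0
  have e : algebraMap K P.KInf ((c⁻¹ • a : P.baseRing) : K) * π ^ d - 1 =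
      algebraMap K P.KInf (algebraMap F K c⁻¹) *
        (x - algebraMap K P.KInf (algebraMap F K c)) := by
    rw [show ((c⁻¹ • a : P.baseRing) : K) = algebraMap F K c⁻¹ * a from Algebra.smul_def _ _,
      map_mul, mul_sub, map_inv₀, map_inv₀, inv_mul_cancel₀ hc', hx]
    ring
  rw [e, norm_mul, norm_const (inv_ne_zero hc0), one_mul]
  exact hxc

theorem monic_cases (hP : P.IsRational) (hπ : P.IsUniformizer π) (d : ℕ) :
    (∃ a₀ : P.baseRing, a₀ ∈ monic π d ∧ P.val (a₀ : K) = WithZero.exp (d : ℤ)) ∨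
      (monic π d = ∅ ∧ ∀ a : P.baseRing, P.val (a : K) ≠ WithZero.exp (d : ℤ)) := by
  rcases Set.eq_empty_or_nonempty (monic π d) with h | ⟨a, ha⟩
  · exact Or.inr ⟨h, fun a ha => (exists_mem_monic hP hπ ha).ne_empty h⟩
  · exact Or.inl ⟨a, ha, ((mem_monic_iff hπ).mp ha).1⟩

theorem finite_monic (h : P.IsStandard) (hπ : P.IsUniformizer π) (d : ℕ) :
    (monic π d).Finite := by
  rcases monic_cases h.rational hπ d with ⟨a₀, ha₀, -⟩ | ⟨he, -⟩
  · have := finite_degreeLT h d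
    rw [monic_eq hπ ha₀]
    exact Set.finite_range _
  · rw [he]; exact Set.finite_empty

theorem finsum_monic (hπ : P.IsUniformizer π) {d : ℕ} [Fintype (P.degreeLT d)]
    {a₀ : P.baseRing} (ha₀ : a₀ ∈ monic π d) {M : Type*} [AddCommMonoid M] (f : P.baseRing → M) :
    ∑ᶠ a ∈ monic π d, f a = ∑ v : P.degreeLT d, f (a₀ + v) := by
  rw [monic_eq hπ ha₀, finsum_mem_range fun v w h => Subtype.ext (add_left_cancel h),
    finsum_eq_sum_of_fintype]

theorem finsum_monic_of_empty {d : ℕ} (h : monic π d = ∅) {M : Type*} [AddCommMonoid M]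
    (f : P.baseRing → M) : ∑ᶠ a ∈ monic π d, f a = 0 := by
  rw [h, finsum_mem_empty]

theorem absVal_powerSum_le (h : P.IsStandard) (hπ : P.IsUniformizer π) (d n : ℕ) :
    P.absVal (powerSum π d n) ≤ ((P.q : ℝ)⁻¹ ^ d) ^ n := by
  rcases monic_cases h.rational hπ d with ⟨a₀, ha₀, hv⟩ | ⟨he, -⟩
  · have := finite_degreeLT h d
    have := Fintype.ofFinite (P.degreeLT d)
    rw [powerSum, finsum_monic hπ ha₀]
    refine abv_sum_le _ isNonarchimedean_absVal _ _ (by have := P.q_pos; positivity) fun v _ => ?_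
    rw [map_div₀, map_pow, map_one, absVal_of_val (val_add_of_mem_degreeLT hv v.2), zpow_natCast,
      inv_pow, one_div, inv_pow]
  · rw [powerSum, finsum_monic_of_empty he, map_zero]
    have := P.q_pos; positivity

theorem absVal_powerSum_le_pow (h : P.IsStandard) (hπ : P.IsUniformizer π) (d : ℕ) {n : ℕ}
    (hn : 1 ≤ n) : P.absVal (powerSum π d n) ≤ (P.q : ℝ)⁻¹ ^ d := by
  have hq : (P.q : ℝ)⁻¹ ≤ 1 := inv_le_one_of_one_le₀ one_lt_q_real.le
  have hq0 : 0 ≤ (P.q : ℝ)⁻¹ := inv_nonneg.mpr q_pos.le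
  exact (absVal_powerSum_le h hπ d n).trans
    (pow_le_of_le_one (pow_nonneg hq0 _) (pow_le_one₀ hq0 hq) (by omega))

theorem absVal_multiSum_le (h : P.IsStandard) (hπ : P.IsUniformizer π) (l : List ℕ) (d : ℕ) :
    P.absVal (multiSum π l d) ≤ 1 := by
  have hq : (P.q : ℝ)⁻¹ ≤ 1 := inv_le_one_of_one_le₀ one_lt_q_real.le
  have hq0 : 0 ≤ (P.q : ℝ)⁻¹ := inv_nonneg.mpr q_pos.le
  induction l generalizing d with
  | nil => simp [multiSum]
  | cons s l ih =>
    rw [multiSum]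
    refine abv_sum_le _ isNonarchimedean_absVal _ _ zero_le_one fun i _ => ?_
    rw [map_mul]
    refine mul_le_one₀ ((absVal_powerSum_le h hπ i s).trans ?_) (P.absVal.nonneg _) (ih i)
    exact pow_le_one₀ (pow_nonneg hq0 _) (pow_le_one₀ hq0 hq)

theorem tendsto_multiSum (h : P.IsStandard) (hπ : P.IsUniformizer π) {l : List ℕ}
    (hl : ∀ s ∈ l, 1 ≤ s) :
    Tendsto (fun d => algebraMap K P.KInf (multiSum π l d)) atTop (𝓝 (zeta π l)) := by
  have hq : (P.q : ℝ)⁻¹ < 1 := inv_lt_one_of_one_lt₀ one_lt_q_real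
  have hq0 : 0 ≤ (P.q : ℝ)⁻¹ := inv_nonneg.mpr q_pos.le
  refine tendsto_nhds_limUnder ?_
  cases l with
  | nil => exact ⟨1, by simp [multiSum]⟩
  | cons s l =>
    have hs : Summable fun i => algebraMap K P.KInf (powerSum π i s * multiSum π l i) := by
      refine Summable.of_norm_bounded (g := fun i => (P.q : ℝ)⁻¹ ^ i)
        (summable_geometric_of_lt_one hq0 hq) fun i => ?_
      rw [norm_toKInf, map_mul]
      exact (mul_le_of_le_one_right (P.absVal.nonneg _) (absVal_multiSum_le h hπ l i)).trans
        (absVal_powerSum_le_pow h hπ i (hl s (by simp)))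
    refine ⟨∑' i, algebraMap K P.KInf (powerSum π i s * multiSum π l i), ?_⟩
    have := hs.hasSum.tendsto_sum_nat
    simpa only [multiSum, map_sum] using this

variable (F) in
theorem one_le_of_mem_expTuple {k s : ℕ} (hs : s ∈ expTuple F k) : 1 ≤ s := by
  simp only [expTuple, List.mem_map, List.mem_range] at hs
  obtain ⟨j, -, rfl⟩ := hs
  have h1 : 1 < Fintype.card F := Fintype.one_lt_card
  exact Nat.mul_pos (by omega) (pow_pos Fintype.card_pos _)

variable (F) in
theorem expTuple_succ (k : ℕ) : expTuple F (k + 1) =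
    (Fintype.card F - 1) :: (expTuple F k).map (· * Fintype.card F) := by
  simp [expTuple, List.range_succ_eq_map, pow_succ, mul_assoc, Function.comp_def]

theorem powerSum_pow_card (h : P.IsStandard) (hπ : P.IsUniformizer π) (d n : ℕ) :
    powerSum π d n ^ Fintype.card F = powerSum π d (n * Fintype.card F) := by
  rcases monic_cases h.rational hπ d with ⟨a₀, ha₀, hv⟩ | ⟨he, -⟩
  · have := finite_degreeLT h d
    have := Fintype.ofFinite (P.degreeLT d)
    rw [powerSum, powerSum, finsum_monic hπ ha₀, finsum_monic hπ ha₀]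
    have := map_sum (FiniteField.frobeniusAlgHom F K)
      (fun v : P.degreeLT d => 1 / ((a₀ + v : P.baseRing) : K) ^ n) Finset.univ
    simp only [FiniteField.coe_frobeniusAlgHom] at this
    rw [this]
    refine Finset.sum_congr rfl fun v _ => ?_
    rw [div_pow, one_pow, pow_mul]
  · rw [powerSum, powerSum, finsum_monic_of_empty he, finsum_monic_of_empty he,
      zero_pow Fintype.card_ne_zero]

/-- With `expTuple_succ`, this identifies the tail sum `S_{<d}((q - 1)q, …)` with the `q`-th power
of the sum for the shorter tuple, which is what the twist produces. -/
theorem multiSum_pow_card (h : P.IsStandard) (hπ : P.IsUniformizer π) (l : List ℕ) (d : ℕ) :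
    multiSum π l d ^ Fintype.card F = multiSum π (l.map (· * Fintype.card F)) d := by
  induction l generalizing d with
  | nil => simp [multiSum]
  | cons s l ih =>
    rw [List.map_cons, multiSum, multiSum]
    have := map_sum (FiniteField.frobeniusAlgHom F K)
      (fun i => powerSum π i s * multiSum π l i) (Finset.range d)
    simp only [FiniteField.coe_frobeniusAlgHom] at this
    rw [this]
    refine Finset.sum_congr rfl fun i _ => ?_
    rw [mul_pow, powerSum_pow_card h hπ, ih]

end Place

/-! ### Pure tensors in the Tate algebra -/

section Tate

variable {F A C : Type*} [Field F] [Fintype F] [CommRing A] [Algebra F A]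
  [NormedField C] [IsUltrametricDist C] [Algebra F C]

namespace Tate

theorem tmul_mul_tmul (a b : A) (c d : C) :
    tmul (F := F) a c * tmul b d = tmul (a * b) (c * d) := by
  rw [tmul, tmul, tmul, ← UniformSpace.Completion.coe_mul, PreTate.tmul_mul_tmul]

theorem add_tmul (a b : A) (c : C) : tmul (F := F) (a + b) c = tmul a c + tmul b c := by
  rw [tmul, tmul, tmul, ← UniformSpace.Completion.coe_add]
  exact congrArg _ (TensorProduct.tmul_add c a b)

theorem tmul_add (a : A) (c d : C) : tmul (F := F) a (c + d) = tmul a c + tmul a d := by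
  rw [tmul, tmul, tmul, ← UniformSpace.Completion.coe_add]
  exact congrArg _ (TensorProduct.add_tmul c d a)

theorem smul_tmul (x : F) (a : A) (c : C) :
    tmul (F := F) (x • a) c = tmul a (algebraMap F C x * c) := by
  rw [tmul, tmul]
  refine congrArg _ ?_
  rw [← Algebra.smul_def]
  exact (TensorProduct.smul_tmul x c a).symm

theorem norm_tmul_le (a : A) (c : C) : ‖tmul (F := F) a c‖ ≤ ‖c‖ := by
  rw [tmul, UniformSpace.Completion.norm_coe, PreTate.norm_def]
  exact_mod_cast PreTate.gaussNorm_tmul_le a c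

variable (F) in
/-- The pure tensor `a ⊗ c` as a function of `c`. -/
noncomputable def tmulHom (a : A) : C →+ Tate F A C :=
  AddMonoidHom.mk' (fun c => tmul a c) (tmul_add a)

theorem tmulHom_apply (a : A) (c : C) : tmulHom F a c = tmul a c := rfl

variable (F C) in
/-- The pure tensor `a ⊗ c` as a function of `a`. -/
noncomputable def tmulLeftHom (c : C) : A →+ Tate F A C :=
  AddMonoidHom.mk' (fun a => tmul a c) fun a b => add_tmul a b c

theorem tmulLeftHom_apply (a : A) (c : C) : tmulLeftHom F C c a = tmul a c := rfl

theorem continuous_tmulHom (a : A) : Continuous (tmulHom (C := C) F a) :=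
  AddMonoidHomClass.continuous_of_bound _ 1 fun c => by
    rw [one_mul]; exact norm_tmul_le a c

theorem chi_mul_const (a : A) (c : C) : chi F C a * const F A c = tmul a c := by
  rw [chi, const, tmul_mul_tmul, mul_one, one_mul]

theorem tmul_mul_const (a : A) (c d : C) : tmul (F := F) a c * const F A d = tmul a (c * d) := by
  rw [const, tmul_mul_tmul, mul_one]

theorem twist_tmul (a : A) (c : C) : twist F A C (tmul a c) = tmul a (c ^ Fintype.card F) := by
  rw [tmul, twist, UniformSpace.Completion.mapRingHom_coe, PreTate.twist_tmul]
  rfl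

theorem continuous_twist : Continuous (twist F A C) :=
  UniformSpace.Completion.continuous_map

/-- Expands in fixed vectors `w j`, so that identities of tensors can be checked on scalar
coefficients. -/
theorem sum_tmul_eq {ι κ : Type*} (s : Finset ι) (t : Finset κ) (w : κ → A) (x : ι → κ → F)
    (c : ι → C) :
    ∑ i ∈ s, tmul (F := F) (∑ j ∈ t, x i j • w j) (c i) =
      ∑ j ∈ t, tmul (w j) (∑ i ∈ s, algebraMap F C (x i j) * c i) := by
  have h1 : ∀ i, tmul (F := F) (∑ j ∈ t, x i j • w j) (c i) =
      ∑ j ∈ t, tmul (w j) (algebraMap F C (x i j) * c i) := fun i => by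
    rw [← tmulLeftHom_apply, map_sum]
    exact Finset.sum_congr rfl fun j _ => by rw [tmulLeftHom_apply, smul_tmul]
  have h2 : ∀ j, tmul (F := F) (w j) (∑ i ∈ s, algebraMap F C (x i j) * c i) =
      ∑ i ∈ s, tmul (w j) (algebraMap F C (x i j) * c i) := fun j => by
    rw [← tmulHom_apply, map_sum]; rfl
  simp_rw [h1, h2]
  exact Finset.sum_comm

end Tate

end Tate

/-! ### The twist of `𝒮_d` and the harmonic product of partial sums -/

namespace Place

variable {F K : Type*} [Field F] [Field K] [Algebra F K] {P : Place F K} [Fintype F]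

theorem norm_toCInf (x : P.KInf) : ‖algebraMap P.KInf P.CInf x‖ = ‖x‖ := by
  have h1 : ‖algebraMap P.KInf P.KInfBar x‖ = ‖x‖ := spectralNorm_extends x
  rw [← h1]
  exact UniformSpace.Completion.norm_coe (E := P.KInfBar) _

theorem algebraMap_K_CInf (x : K) :
    algebraMap K P.CInf x = algebraMap P.KInf P.CInf (algebraMap K P.KInf x) := rfl

theorem algebraMap_F_CInf (x : F) :
    algebraMap F P.CInf x = algebraMap K P.CInf (algebraMap F K x) := rfl

theorem norm_algebraMap_CInf (x : K) : ‖algebraMap K P.CInf x‖ = P.absVal x := by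
  rw [algebraMap_K_CInf, norm_toCInf, norm_toKInf]

theorem continuous_toCInf : Continuous (algebraMap P.KInf P.CInf) :=
  AddMonoidHomClass.continuous_of_bound _ 1 fun c => by
    rw [one_mul]; exact (norm_toCInf c).le

variable {π : P.KInf}

theorem tateSum_eq {a₀ : P.baseRing} (hπ : P.IsUniformizer π) {d : ℕ} [Fintype (P.degreeLT d)]
    (ha₀ : a₀ ∈ monic π d) : tateSum π d = ∑ v : P.degreeLT d, Tate.tmul (F := F) (a₀ + v : P.baseRing)
      (algebraMap K P.CInf (1 / ((a₀ + v : P.baseRing) : K))) := by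
  rw [tateSum, finsum_monic hπ ha₀]
  exact Finset.sum_congr rfl fun v _ => Tate.chi_mul_const _ _

theorem tateSum_of_empty {d : ℕ} (h : monic π d = ∅) : tateSum π d = 0 :=
  finsum_monic_of_empty h _

/-- The sums `𝒮_i` for `i < d` combine to a sum over all elements of degree less than `d`. -/
theorem sum_tateSum (h : P.IsStandard) (hπ : P.IsUniformizer π) (d : ℕ) :
    ∀ [Fintype (P.degreeLT d)], ∑ i ∈ Finset.range d, tateSum π i = -∑ u : P.degreeLT d, Tate.tmul (F := F) (u : P.baseRing)
      (algebraMap K P.CInf (1 / ((u : P.baseRing) : K))) := by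
  induction d with
  | zero =>
    intro _
    rw [Finset.range_zero, Finset.sum_empty, eq_comm, neg_eq_zero]
    refine Finset.sum_eq_zero fun u _ => ?_
    have hu : (u : P.baseRing) = 0 := (Submodule.mem_bot F).mp ((degreeLT_zero h).le u.2)
    rw [hu, ← Tate.tmulLeftHom_apply, map_zero]
  | succ d ih =>
    intro _
    have := finite_degreeLT h d
    have := Fintype.ofFinite (P.degreeLT d)
    rw [Finset.sum_range_succ, ih]
    rcases monic_cases h.rational hπ d with ⟨a₀, ha₀, hv⟩ | ⟨he, hd⟩
    · classical
      set f : P.baseRing → P.TateInf := fun u =>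
        Tate.tmul (F := F) u (algebraMap K P.CInf (1 / (u : K))) with hf
      have hfc : ∀ (c : F) (u : P.baseRing), c ≠ 0 → f (c • u) = f u := by
        intro c u hc
        have hc' : algebraMap F K c ≠ 0 := by simpa using hc
        simp only [hf]
        rw [Tate.smul_tmul, algebraMap_F_CInf, ← map_mul,
          show ((c • u : P.baseRing) : K) = algebraMap F K c * u from Algebra.smul_def _ _]
        congr 2
        rw [mul_one_div, div_mul_cancel_left₀ hc', one_div]
      -- The coset `c • a₀ + V` is `c • (a₀ + V)`, and the summand is invariant under scaling. The
      -- `q - 1` nonzero values of `c` thus contribute `(q - 1) 𝒮_d = -𝒮_d`, while `c = 0` gives the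
      -- induction hypothesis.
      have hcos : ∀ c : F, c ≠ 0 → ∑ v : P.degreeLT d, f (c • a₀ + v) = tateSum π d := by
        intro c hc
        rw [tateSum_eq hπ ha₀, ← (LinearEquiv.smulOfNeZero F (P.degreeLT d) c hc).toEquiv.sum_comp]
        refine Finset.sum_congr rfl fun v _ => ?_
        exact (congrArg f (smul_add c a₀ (v : P.baseRing)).symm).trans (hfc c _ hc)
      rw [sum_degreeLT_succ h.rational hv f, ← Finset.add_sum_erase _ _ (Finset.mem_univ (0 : F)),
        Finset.sum_congr rfl fun c hc => hcos c (Finset.ne_of_mem_erase hc)]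
      have hchar : (Fintype.card F : P.CInf) = 0 := card_cast_eq_zero (F := F)
      have hT : (Fintype.card F : P.TateInf) = 0 := by
        have h1 : (Tate.tmulHom F (1 : P.baseRing) (Fintype.card F : P.CInf) : P.TateInf) =
            Fintype.card F := by
          rw [← nsmul_one, map_nsmul]
          rw [show Tate.tmulHom F (1 : P.baseRing) (1 : P.CInf) = (1 : P.TateInf) from rfl, nsmul_one]
        rw [← h1, hchar, map_zero]
      rw [Finset.sum_const, Finset.card_erase_of_mem (Finset.mem_univ _), Finset.card_univ,
        nsmul_eq_mul, Nat.cast_sub Fintype.card_pos, hT]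
      simp only [zero_smul, zero_add, hf]
      push_cast
      ring
    · rw [tateSum_of_empty he, add_zero]
      congr 1
      have e := degreeLT_succ_eq hd
      exact Fintype.sum_equiv (LinearEquiv.ofEq _ _ e.symm).toEquiv _ _ fun _ => rfl

theorem twist_tateSum (h : P.IsStandard) (hπ : P.IsUniformizer π) (d : ℕ) :
    Tate.twist F P.baseRing P.CInf (tateSum π d) =
      (∑ i ∈ Finset.range (d + 1), tateSum π i) *
        Tate.const F P.baseRing (algebraMap K P.CInf (powerSum π d (Fintype.card F - 1))) := by
  classical
  have := finite_degreeLT h d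
  have := Fintype.ofFinite (P.degreeLT d)
  have := finite_degreeLT h (d + 1)
  have := Fintype.ofFinite (P.degreeLT (d + 1))
  rcases monic_cases h.rational hπ d with ⟨a₀, ha₀, hv⟩ | ⟨he, hd⟩
  · set U := P.degreeLT (d + 1) with hU
    have haU : a₀ ∈ U := mem_degreeLT_succ.mpr hv.le
    set V : Submodule F U := (P.degreeLT d).comap U.subtype with hV
    let e : P.degreeLT d ≃ₗ[F] V :=
      (Submodule.comapSubtypeEquivOfLe (degreeLT_mono (Nat.le_succ d))).symm
    have : Fintype V := Fintype.ofFinite V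
    have hcard : Fintype.card U = Fintype.card F * Fintype.card V := by
      rw [← Fintype.card_congr e.toEquiv]
      exact card_degreeLT_succ h.rational hv
    have haV : (⟨a₀, haU⟩ : U) ∉ V := by
      intro h1
      have h2 : P.val (a₀ : K) < WithZero.exp (d : ℤ) := h1
      rw [hv] at h2
      exact lt_irrefl _ h2
    set ι : U →ₗ[F] K := P.baseRing.val.toLinearMap ∘ₗ U.subtype with hι
    have hιinj : Function.Injective ι := Subtype.val_injective.comp Subtype.val_injective
    have b := Module.finBasis F U
    have hb : ∀ u : U, (u : P.baseRing) = ∑ j, b.repr u j • (b j : P.baseRing) := fun u => by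
      have h1 := congrArg U.subtype (b.sum_repr u)
      rw [map_sum] at h1
      exact h1.symm
    have hav : ∀ v : P.degreeLT d, a₀ + (v : P.baseRing) = ((⟨a₀, haU⟩ + (e v : U) : U) : P.baseRing) :=
      fun v => rfl
    rw [sum_tateSum h hπ, tateSum_eq hπ ha₀, powerSum, finsum_monic hπ ha₀, map_sum]
    have hL : ∀ v : P.degreeLT d, Tate.twist F P.baseRing P.CInf
        (Tate.tmul (F := F) (a₀ + v : P.baseRing) (algebraMap K P.CInf (1 / ((a₀ + v : P.baseRing) : K))))
        = Tate.tmul (F := F) (∑ j, b.repr (⟨a₀, haU⟩ + (e v : U)) j • (b j : P.baseRing))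
          (algebraMap K P.CInf (1 / ι (⟨a₀, haU⟩ + (e v : U)) ^ Fintype.card F)) := fun v => by
      rw [Tate.twist_tmul, ← map_pow, ← hb, div_pow, one_pow]
      rfl
    have hR : ∀ u : U, Tate.tmul (F := F) (u : P.baseRing) (algebraMap K P.CInf (1 / ((u : P.baseRing) : K)))
        = Tate.tmul (F := F) (∑ j, b.repr u j • (b j : P.baseRing)) (algebraMap K P.CInf (1 / ι u)) :=
      fun u => by rw [← hb]; rfl
    rw [Finset.sum_congr rfl fun v _ => hL v, Finset.sum_congr rfl fun u _ => hR u,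
      Tate.sum_tmul_eq, Tate.sum_tmul_eq, ← Finset.sum_neg_distrib, Finset.sum_mul]
    refine Finset.sum_congr rfl fun j _ => ?_
    -- The coefficient at `b j` on both sides is the scalar identity for the `j`-th coordinate
    -- functional.
    have key := sum_div_pow_card ι hιinj V hcard ⟨a₀, haU⟩ haV
      (Algebra.linearMap F K ∘ₗ b.coord j)
    rw [← Tate.tmulHom_apply, ← Tate.tmulHom_apply, ← map_neg, Tate.tmulHom_apply,
      Tate.tmulHom_apply, Tate.tmul_mul_const]
    congr 1
    simp only [algebraMap_F_CInf, ← map_mul, ← map_sum, ← map_neg]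
    congr 1
    rw [← e.toEquiv.sum_comp, ← e.toEquiv.sum_comp] at key
    simp only [mul_one_div]
    exact key
  · rw [tateSum_of_empty he, powerSum, finsum_monic_of_empty he, map_zero, map_zero]
    rw [Tate.const, ← Tate.tmulHom_apply, map_zero, mul_zero]

/-- The harmonic product formula for partial sums. -/
theorem partial_sum_identity (h : P.IsStandard) (hπ : P.IsUniformizer π) (k D : ℕ) :
    (∑ d ∈ Finset.range D, tateSum π d) *
      Tate.const F P.baseRing (algebraMap K P.CInf (multiSum π (expTuple F (k + 1)) D)) =
    ∑ d ∈ Finset.range D, ZTerm π (k + 1) d +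
      ∑ d ∈ Finset.range D, Tate.twist F P.baseRing P.CInf (ZTerm π k d) := by
  have hadd : ∀ x y : P.CInf, Tate.const F P.baseRing (x + y) =
      Tate.const F P.baseRing x + Tate.const F P.baseRing y := Tate.tmul_add 1
  have hmul : ∀ x y : P.CInf, Tate.const F P.baseRing (x * y) =
      Tate.const F P.baseRing x * Tate.const F P.baseRing y := fun x y =>
    (Tate.tmul_mul_const 1 x y).symm
  induction D with
  | zero => simp
  | succ D ih =>
    have h1 : multiSum π (expTuple F (k + 1)) (D + 1) = multiSum π (expTuple F (k + 1)) D +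
        powerSum π D (Fintype.card F - 1) * multiSum π (expTuple F k) D ^ Fintype.card F := by
      rw [multiSum_pow_card h hπ, expTuple_succ, multiSum, multiSum, Finset.sum_range_succ]
    have h2 : Tate.twist F P.baseRing P.CInf (ZTerm π k D) =
        Tate.twist F P.baseRing P.CInf (tateSum π D) * Tate.const F P.baseRing
          (algebraMap K P.CInf (multiSum π (expTuple F k) D ^ Fintype.card F)) := by
      rw [ZTerm, map_mul, Tate.const, Tate.twist_tmul, map_pow]
      rfl
    -- Passing from `D` to `D + 1`, the left side grows by `𝒮_D` times the old multiple sum, which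
    -- is the new term of `Z_{k+1}`, and by `𝒮_0 + ⋯ + 𝒮_D` times the new term of the multiple sum,
    -- which by `twist_tateSum` is the twisted term of `Z_k`.
    rw [Finset.sum_range_succ (fun d => ZTerm π (k + 1) d), Finset.sum_range_succ (fun d =>
      Tate.twist F P.baseRing P.CInf (ZTerm π k d)), add_add_add_comm, ← ih, h2, twist_tateSum h hπ,
      h1, ZTerm, map_add, map_mul, hadd, hmul, Finset.sum_range_succ]
    ring

end Place

/-! ### Entire functions -/

/-- A doubly exponentially decreasing sequence. -/
noncomputable def decay (q : ℝ) (b e d : ℕ) : ℝ := q⁻¹ ^ (b ^ (d / e - 1) - 1)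

theorem eventually_mul_le_pow {b e : ℕ} (hb : 2 ≤ b) (he : 0 < e) (C : ℕ) :
    ∀ᶠ d : ℕ in atTop, C * d ≤ b ^ (d / e - 1) - 1 := by
  have h1 := tendsto_pow_const_div_const_pow_of_one_lt 1 (one_lt_two : (1 : ℝ) < 2)
  have hpos : (0 : ℝ) < 1 / (4 * ((C + 1) * e)) := by positivity
  -- In the factor `4 * (C + 1)`, one `2` pays for the exponent `d / e - 1` instead of `d / e`, the
  -- other for rounding in `d / e`, and the `+ 1` for the subtracted `1`.
  have h2 : ∀ᶠ m : ℕ in atTop, 4 * ((C + 1) * e) * m ≤ 2 ^ m := by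
    filter_upwards [h1.eventually (gt_mem_nhds hpos)] with m hm
    rw [pow_one, div_lt_div_iff₀ (by positivity) (by positivity), one_mul] at hm
    have : ((4 * ((C + 1) * e) * m : ℕ) : ℝ) ≤ ((2 ^ m : ℕ) : ℝ) := by
      push_cast
      linarith
    exact_mod_cast this
  have h3 : Tendsto (fun d : ℕ => d / e) atTop atTop := Nat.tendsto_div_const_atTop he.ne'
  filter_upwards [h3.eventually h2, h3.eventually (eventually_ge_atTop 1)] with d hd hd1
  obtain ⟨m, hm⟩ : ∃ m, d / e = m + 1 := ⟨d / e - 1, by omega⟩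
  have h4 : d < e * (m + 2) := by
    have := Nat.lt_mul_div_succ d he
    rw [hm] at this
    exact this
  rw [hm] at hd
  rw [hm, Nat.add_sub_cancel]
  have h5 : 2 ^ m ≤ b ^ m := Nat.pow_le_pow_left hb m
  rw [pow_succ] at hd
  have h6 : C * d + 1 ≤ 2 ^ m := by
    have h7 : C * d ≤ C * (e * (m + 2)) := Nat.mul_le_mul_left C h4.le
    have h8 : 1 ≤ e * (m + 1) := Nat.mul_pos he (by omega)
    have h9 : C * (e * (m + 2)) ≤ 2 * (C * (e * (m + 1))) := by nlinarith [Nat.zero_le (C * e * m)]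
    nlinarith
  omega

theorem tendsto_decay_mul_pow {q : ℝ} (hq : 1 < q) {b e : ℕ} (hb : 2 ≤ b) (he : 0 < e) {ρ : ℝ}
    (hρ : 1 < ρ) : Tendsto (fun d => decay q b e d * ρ ^ d) atTop (𝓝 0) := by
  obtain ⟨C, hC⟩ := pow_unbounded_of_one_lt (2 * ρ) hq
  have hq0 : 0 < q := zero_lt_one.trans hq
  refine squeeze_zero' (Eventually.of_forall fun d => ?_) ?_
    (tendsto_pow_atTop_nhds_zero_of_lt_one (r := (1 / 2 : ℝ)) (by norm_num) (by norm_num))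
  · unfold decay; positivity
  · filter_upwards [eventually_mul_le_pow hb he C] with d hd
    calc decay q b e d * ρ ^ d ≤ q⁻¹ ^ (C * d) * ρ ^ d := by
          unfold decay
          gcongr ?_ * _
          exact pow_le_pow_of_le_one (by positivity) (inv_le_one_of_one_le₀ hq.le) hd
      _ = (ρ / q ^ C) ^ d := by rw [pow_mul, ← mul_pow, inv_pow, div_eq_inv_mul]
      _ ≤ (1 / 2) ^ d := by
          refine pow_le_pow_left₀ (by positivity) ?_ d
          rw [div_le_iff₀ (by positivity)]
          linarith

/-! ### Decay of the coefficients of `𝒮_d`, entireness, and the limit -/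

namespace Place

variable {F K : Type*} [Field F] [Field K] [Algebra F K] {P : Place F K} [Fintype F]
  {π : P.KInf}

variable (π) in
/-- The coefficient of `𝒮_d` at the `i`-th vector of a basis. -/
noncomputable def coeffSum (β : Module.Basis ℕ F P.baseRing) (d i : ℕ) : K :=
  ∑ᶠ a ∈ monic π d, algebraMap F K (β.repr a i) * (a : K)⁻¹

theorem absVal_le_of_mem_degreeLT (h : P.IsStandard) {d : ℕ} {a b : P.baseRing}
    (ha : a ∈ P.degreeLT d) (hb : P.val (b : K) = WithZero.exp (d : ℤ)) :
    P.absVal (a : K) ≤ (P.q : ℝ)⁻¹ * P.absVal (b : K) := by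
  have hq := P.q_pos
  by_cases h0 : a = 0
  · rw [h0, ZeroMemClass.coe_zero, map_zero]
    exact mul_nonneg (inv_nonneg.mpr hq.le) (P.absVal.nonneg _)
  · obtain ⟨n, hn⟩ := h.exists_val_eq_exp h0
    rw [mem_degreeLT, hn, WithZero.exp_lt_exp] at ha
    rw [absVal_of_val hn, absVal_of_val hb, inv_mul_eq_div, le_div_iff₀ hq, ← zpow_add_one₀ hq.ne']
    exact zpow_le_zpow_right₀ one_lt_q_real.le (by omega)

theorem absVal_const_le_one (c : F) : P.absVal (algebraMap F K c) ≤ 1 :=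
  absVal_le_one_iff.mpr (val_const_le_one c)

/-- The space of elements of degree less than `d` has at least `q ^ (d / e)` elements, and a
hyperplane in it at least `q ^ (d / e - 1)`; each nonzero vector of the hyperplane contributes a
factor at most `q⁻¹`. -/
theorem exists_absVal_coeffSum_le (h : P.IsStandard) (hπ : P.IsUniformizer π) :
    ∃ e : ℕ, 0 < e ∧ ∀ (β : Module.Basis ℕ F P.baseRing) (d i : ℕ),
      P.absVal (coeffSum π β d i) ≤ decay P.q (Fintype.card F) e d := by
  obtain ⟨e, he, hcard⟩ := exists_card_degreeLT_ge h
  refine ⟨e, he, fun β d i => ?_⟩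
  have hq0 : 0 ≤ (P.q : ℝ)⁻¹ := inv_nonneg.mpr q_pos.le
  have hq1 : (P.q : ℝ)⁻¹ ≤ 1 := inv_le_one_of_one_le₀ one_lt_q_real.le
  rcases monic_cases h.rational hπ d with ⟨a₀, ha₀, hv⟩ | ⟨hempty, -⟩
  · have := finite_degreeLT h d
    have := Fintype.ofFinite (P.degreeLT d)
    rw [coeffSum, finsum_monic hπ ha₀]
    have hval : ∀ v : P.degreeLT d, P.absVal ((a₀ + v : P.baseRing) : K) = (P.q : ℝ) ^ d :=
      fun v => by rw [absVal_of_val (val_add_of_mem_degreeLT hv v.2), zpow_natCast]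
    have hone : ∀ v : P.degreeLT d, 1 ≤ P.absVal ((a₀ + v : P.baseRing) : K) := fun v => by
      rw [hval]; exact one_le_pow₀ one_lt_q_real.le
    rcases Nat.eq_zero_or_pos (d / e) with hd | hd
    -- For `d < e` the truncated exponent is `0` and the claimed bound is `1`.
    · rw [decay, hd]
      simp only [zero_tsub, pow_zero, tsub_self]
      refine abv_sum_le _ isNonarchimedean_absVal _ _ zero_le_one fun v _ => ?_
      rw [map_mul, map_inv₀]
      exact mul_le_one₀ (absVal_const_le_one _) (inv_nonneg.mpr (P.absVal.nonneg _))
        (inv_le_one_of_one_le₀ (hone v))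
    · have hn : Fintype.card F * (Fintype.card F ^ (d / e - 1) - 1 + 1) ≤
          Fintype.card (P.degreeLT d) := by
        have h1 : 0 < Fintype.card F ^ (d / e - 1) := pow_pos Fintype.card_pos _
        rw [Nat.sub_add_cancel h1, ← pow_succ', Nat.sub_add_cancel hd]
        exact hcard d _ (Nat.mul_div_le d e)
      have key := abv_sum_mul_inv_add_le P.absVal isNonarchimedean_absVal
        (P.baseRing.val.toLinearMap ∘ₗ (P.degreeLT d).subtype)
        (Subtype.val_injective.comp Subtype.val_injective) (a₀ : K) (P.q : ℝ)⁻¹ hq0 hq1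
        (fun v => hone v) (fun u v => absVal_le_of_mem_degreeLT h u.2
          (val_add_of_mem_degreeLT hv v.2))
        (β.coord i ∘ₗ (P.degreeLT d).subtype) (β.repr a₀ i) absVal_const_le_one _ hn
      refine le_of_eq_of_le (congrArg P.absVal (Finset.sum_congr rfl fun v _ => ?_)) key
      rw [map_add, Finsupp.add_apply]
      rfl
  · rw [coeffSum, finsum_monic_of_empty hempty, map_zero]
    exact pow_nonneg hq0 _

theorem coeffSum_eq_zero (hπ : P.IsUniformizer π) {β : Module.Basis ℕ F P.baseRing}
    (hβ : StrictMono fun i => P.deg (β i : K)) {d i : ℕ} (hi : (d : ℤ) < P.deg (β i : K)) :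
    coeffSum π β d i = 0 := by
  refine finsum_mem_eq_zero_of_forall_eq_zero fun a ha => ?_
  have hr : β.repr a i = 0 := by
    by_contra hne
    have := deg_basis_lt_of_repr_ne_zero hβ (d + 1) a
      (mem_degreeLT_succ.mpr ((mem_monic_iff hπ).mp ha).1.le) i hne
    push_cast at this
    omega
  rw [hr, map_zero, zero_mul]

theorem exists_deg_basis (h : P.IsStandard) {β : Module.Basis ℕ F P.baseRing}
    (hβ : StrictMono fun i => P.deg (β i : K)) :
    ∃ δ : ℕ → ℕ, (∀ i, P.deg (β i : K) = δ i) ∧ ∀ i, i ≤ δ i := by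
  choose δ hδ using fun i => h.exists_val_eq_exp (β.ne_zero i)
  have h1 : ∀ i, P.deg (β i : K) = δ i := fun i => deg_eq_of_val (hδ i)
  refine ⟨δ, h1, fun i => StrictMono.le_apply (f := δ) fun i j hij => ?_⟩
  have := hβ hij
  simp only [h1] at this
  exact_mod_cast this

theorem hasSum_coeffSum (h : P.IsStandard) (hπ : P.IsUniformizer π)
    {β : Module.Basis ℕ F P.baseRing} (hβ : StrictMono fun i => P.deg (β i : K)) (d : ℕ) :
    HasSum (fun i => Tate.tmul (F := F) (β i) (algebraMap K P.CInf (coeffSum π β d i)))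
      (tateSum π d) := by
  obtain ⟨δ, hδ, hδi⟩ := exists_deg_basis h hβ
  rcases monic_cases h.rational hπ d with ⟨a₀, ha₀, hv⟩ | ⟨hempty, -⟩
  · have := finite_degreeLT h d
    have := Fintype.ofFinite (P.degreeLT d)
    -- Since `i ≤ δ i`, only the indices `i ≤ d` can occur in elements of degree `d`.
    have hsum : tateSum π d = ∑ i ∈ Finset.range (d + 1),
        Tate.tmul (F := F) (β i) (algebraMap K P.CInf (coeffSum π β d i)) := by
      have hrepr : ∀ v : P.degreeLT d, a₀ + (v : P.baseRing) =
          ∑ i ∈ Finset.range (d + 1), β.repr (a₀ + v) i • β i := by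
        intro v
        conv_lhs => rw [← β.linearCombination_repr (a₀ + (v : P.baseRing))]
        rw [Finsupp.linearCombination_apply]
        refine Finsupp.sum_of_support_subset _ (fun i hi => ?_) _ (by simp)
        have h1 := deg_basis_lt_of_repr_ne_zero hβ (d + 1) (a₀ + v)
          (mem_degreeLT_succ.mpr (val_add_of_mem_degreeLT hv v.2).le) i
          (Finsupp.mem_support_iff.mp hi)
        have h2 := hδi i
        rw [hδ] at h1
        rw [Finset.mem_range]
        omega
      rw [tateSum_eq hπ ha₀]
      calc _ = ∑ v : P.degreeLT d,
            Tate.tmul (F := F) (∑ i ∈ Finset.range (d + 1), β.repr (a₀ + v) i • β i)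
              (algebraMap K P.CInf (1 / ((a₀ + v : P.baseRing) : K))) :=
            Finset.sum_congr rfl fun v _ => by rw [← hrepr v]
        _ = _ := by
          rw [Tate.sum_tmul_eq]
          refine Finset.sum_congr rfl fun i _ => ?_
          rw [coeffSum, finsum_monic hπ ha₀, map_sum]
          congr 1
          refine Finset.sum_congr rfl fun v _ => ?_
          rw [map_mul, one_div, algebraMap_F_CInf]
    rw [hsum]
    refine hasSum_sum_of_ne_finset_zero fun i hi => ?_
    rw [coeffSum_eq_zero hπ hβ, map_zero, ← Tate.tmulHom_apply, map_zero]
    rw [hδ]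
    have := hδi i
    rw [Finset.mem_range] at hi
    omega
  · rw [tateSum_of_empty hempty]
    have : ∀ i, Tate.tmul (F := F) (β i) (algebraMap K P.CInf (coeffSum π β d i)) = 0 := fun i => by
      rw [coeffSum, finsum_monic_of_empty hempty, map_zero, ← Tate.tmulHom_apply, map_zero]
    simp only [this]
    exact hasSum_zero

theorem norm_le_of_hasSum {ι E : Type*} [SeminormedAddCommGroup E] [IsUltrametricDist E]
    {f : ι → E} {a : E} (h : HasSum f a) {r : ℝ} (hr : 0 ≤ r) (hf : ∀ i, ‖f i‖ ≤ r) : ‖a‖ ≤ r :=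
  le_of_tendsto h.norm (Eventually.of_forall fun _ =>
    IsUltrametricDist.norm_sum_le_of_forall_le_of_nonneg hr fun i _ => hf i)

/-- A series of multiples of the functions `𝒮_d` by bounded scalars is entire. -/
theorem isEntire_of_bounded (h : P.IsStandard) (hπ : P.IsUniformizer π) (s : ℕ → K)
    (hs : ∀ d, P.absVal (s d) ≤ 1) :
    ∃ f : P.TateInf, IsEntire f ∧
      HasSum (fun d => tateSum π d * Tate.const F P.baseRing (algebraMap K P.CInf (s d))) f := by
  obtain ⟨β, hβ⟩ := exists_basis h
  obtain ⟨δ, hδ, hδi⟩ := exists_deg_basis h hβ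
  obtain ⟨e, he, hbound⟩ := exists_absVal_coeffSum_le h hπ
  set B : ℕ → ℝ := decay P.q (Fintype.card F) e with hB
  have hB0 : ∀ d, 0 ≤ B d := fun d => pow_nonneg (inv_nonneg.mpr q_pos.le) _
  have hBt : ∀ ρ : ℝ, 1 < ρ → Tendsto (fun d => B d * ρ ^ d) atTop (𝓝 0) := fun ρ hρ =>
    tendsto_decay_mul_pow one_lt_q_real Fintype.one_lt_card he hρ
  set t : ℕ → ℕ → P.CInf := fun d i => algebraMap K P.CInf (coeffSum π β d i * s d) with ht
  have htB : ∀ d i, ‖t d i‖ ≤ B d := fun d i => by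
    rw [ht, norm_algebraMap_CInf, map_mul]
    exact (mul_le_of_le_one_right (P.absVal.nonneg _) (hs d)).trans (hbound β d i)
  have ht0 : ∀ d i, d < δ i → t d i = 0 := fun d i hd => by
    simp only [ht]
    rw [coeffSum_eq_zero hπ hβ (by rw [hδ]; exact_mod_cast hd), zero_mul, map_zero]
  -- The rate `4⁻ᵈ` splits as `2⁻ᵈ · 2⁻ᵈ`; as nonzero entries have `i ≤ d`, the second factor is at
  -- most `2⁻ⁱ`, which makes the double series summable.
  obtain ⟨M, hM⟩ := (hBt 4 (by norm_num)).bddAbove_range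
  have hM' : ∀ d, B d ≤ M * (1 / 4) ^ d := fun d => by
    have h1 : B d * 4 ^ d ≤ M := hM ⟨d, rfl⟩
    rw [one_div, inv_pow, ← div_eq_mul_inv, le_div_iff₀ (by positivity)]
    exact h1
  have hM0 : 0 ≤ M := by
    have h1 := (hB0 0).trans (hM' 0)
    simpa using h1
  have hgeo : Summable fun n : ℕ => (1 / 2 : ℝ) ^ n :=
    summable_geometric_of_lt_one (by norm_num) (by norm_num)
  set T : ℕ × ℕ → P.TateInf := fun p => Tate.tmul (F := F) (β p.2) (t p.1 p.2) with hT
  have hTs : Summable T := by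
    refine Summable.of_norm_bounded (g := fun p : ℕ × ℕ => M * ((1 / 2) ^ p.1 * (1 / 2) ^ p.2))
      ((hgeo.mul_of_nonneg hgeo (fun _ => by positivity) fun _ => by positivity).mul_left M)
      fun ⟨d, i⟩ => ?_
    refine (Tate.norm_tmul_le _ _).trans ?_
    by_cases hdi : d < δ i
    · simp only [ht0 d i hdi, norm_zero]
      positivity
    · have hid : i ≤ d := (hδi i).trans (not_lt.mp hdi)
      refine (htB d i).trans ((hM' d).trans ?_)
      gcongr
      rw [show (1 / 4 : ℝ) = 1 / 2 * (1 / 2) by norm_num, mul_pow]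
      gcongr ?_ * ?_
      exact pow_le_pow_of_le_one (by norm_num) (by norm_num) hid
  have hrow : ∀ d, HasSum (fun i => T (d, i))
      (tateSum π d * Tate.const F P.baseRing (algebraMap K P.CInf (s d))) := fun d => by
    have h1 := (hasSum_coeffSum h hπ hβ d).mul_right
      (Tate.const F P.baseRing (algebraMap K P.CInf (s d)))
    refine h1.congr_fun ?_
    intro i
    simp only [hT, ht]
    rw [Tate.tmul_mul_const, map_mul]
  have hcs : ∀ i, Summable fun d => t d i := fun i => by
    refine Summable.of_norm_bounded (g := fun d => M * (1 / 4) ^ d)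
      ((summable_geometric_of_lt_one (by norm_num) (by norm_num)).mul_left M) fun d => ?_
    exact (htB d i).trans (hM' d)
  set c : ℕ → P.CInf := fun i => ∑' d, t d i with hc
  have hcol : ∀ i, HasSum (fun d => T (d, i)) (Tate.tmul (F := F) (β i) (c i)) := fun i =>
    (hcs i).hasSum.map (Tate.tmulHom F (β i)) (Tate.continuous_tmulHom _)
  -- The same double series is summed by rows, giving the series of multiples of `𝒮_d`, and by
  -- columns, giving the expansion in the basis `β`.
  refine ⟨∑' p, T p, ⟨β, c, hβ, fun ρ hρ => ?_, ?_⟩, hTs.hasSum.prod_fiberwise hrow⟩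
  · rw [Metric.tendsto_atTop]
    intro ε hε
    obtain ⟨D, hD⟩ := (Metric.tendsto_atTop.mp (hBt ρ hρ)) (ε / 2) (half_pos hε)
    refine ⟨D, fun i hi => ?_⟩
    have hρ0 : 0 < ρ := zero_lt_one.trans hρ
    -- Only `d ≥ δ i` contributes to `c i`, so `ρ ^ δ i ≤ ρ ^ d` and the decay in `d` becomes decay
    -- in `δ i`.
    have hle : ‖c i‖ ≤ ε / 2 / ρ ^ δ i := by
      refine norm_le_of_hasSum (hcs i).hasSum (by positivity) fun d => ?_
      by_cases hdi : d < δ i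
      · rw [ht0 d i hdi, norm_zero]; positivity
      · rw [le_div_iff₀ (by positivity)]
        have hid := not_lt.mp hdi
        have h1 := hD d ((hi.le.trans (hδi i)).trans hid)
        rw [dist_zero_right, Real.norm_of_nonneg (by have := hB0 d; positivity)] at h1
        refine le_trans ?_ h1.le
        have h2 := htB d i
        have h3 := hB0 d
        gcongr
        exact hρ.le
    rw [hδ, zpow_natCast, dist_zero_right, Real.norm_of_nonneg (by positivity)]
    rw [le_div_iff₀ (by positivity)] at hle
    linarith
  · have h1 := ((Equiv.prodComm ℕ ℕ).hasSum_iff (f := T)).mpr hTs.hasSum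
    exact h1.prod_fiberwise hcol

theorem IsEntire.twist (h : P.IsStandard) {f : P.TateInf} (hf : IsEntire f) :
    IsEntire (Tate.twist F P.baseRing P.CInf f) := by
  obtain ⟨β, c, hβ, hc, hs⟩ := hf
  obtain ⟨δ, hδ, -⟩ := exists_deg_basis h hβ
  refine ⟨β, fun i => c i ^ Fintype.card F, hβ, fun ρ hρ => ?_, ?_⟩
  · have hρ0 : 0 < ρ := zero_lt_one.trans hρ
    refine squeeze_zero' (Eventually.of_forall fun i => by positivity) ?_ (hc ρ hρ)
    filter_upwards [(hc ρ hρ).eventually (gt_mem_nhds one_pos)] with i hi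
    rw [hδ, zpow_natCast] at hi ⊢
    -- Once a coefficient has absolute value at most `1`, raising it to the power `q` does not
    -- increase it.
    have h1 : ‖c i‖ ≤ 1 :=
      (le_mul_of_one_le_right (norm_nonneg _) (one_le_pow₀ hρ.le)).trans hi.le
    rw [norm_pow]
    gcongr
    exact pow_le_of_le_one (norm_nonneg _) h1 Fintype.card_ne_zero
  · have h1 := hs.map (Tate.twist F P.baseRing P.CInf) Tate.continuous_twist
    refine h1.congr_fun ?_
    intro i
    exact (Tate.twist_tmul _ _).symm

theorem Z_spec (h : P.IsStandard) (hπ : P.IsUniformizer π) (k : ℕ) :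
    IsEntire (Z π k) ∧ HasSum (ZTerm π k) (Z π k) := by
  obtain ⟨f, hf, hs⟩ := isEntire_of_bounded h hπ (multiSum π (expTuple F k))
    fun d => absVal_multiSum_le h hπ _ d
  have h1 : HasSum (ZTerm π k) f := hs
  rw [Z, h1.tsum_eq]
  exact ⟨hf, h1⟩

/-- The limit of `partial_sum_identity`, by continuity of multiplication, of the twist and of the
embedding of constants. -/
theorem harmonic_product (h : P.IsStandard) (hπ : P.IsUniformizer π) (k : ℕ) :
    Z π 0 * Tate.const F P.baseRing (algebraMap P.KInf P.CInf (zeta π (expTuple F (k + 1)))) =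
      Z π (k + 1) + Tate.twist F P.baseRing P.CInf (Z π k) := by
  have h0 : ∀ d, ZTerm π 0 d = tateSum π d := fun d => by
    rw [ZTerm, show expTuple F 0 = [] from rfl, multiSum, map_one]
    exact mul_one _
  have hZ := (Z_spec h hπ 0).2.tendsto_sum_nat
  simp only [h0] at hZ
  have hζ : Tendsto (fun D => Tate.const F P.baseRing
      (algebraMap K P.CInf (multiSum π (expTuple F (k + 1)) D))) atTop
      (𝓝 (Tate.const F P.baseRing
        (algebraMap P.KInf P.CInf (zeta π (expTuple F (k + 1)))))) :=
    (((Tate.continuous_tmulHom (F := F) (1 : P.baseRing)).comp continuous_toCInf).tendsto _).comp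
      (tendsto_multiSum h hπ fun s hs => one_le_of_mem_expTuple F hs)
  have hL := hZ.mul hζ
  have hR := (Z_spec h hπ (k + 1)).2.tendsto_sum_nat.add
    ((Z_spec h hπ k).2.map (Tate.twist F P.baseRing P.CInf) Tate.continuous_twist).tendsto_sum_nat
  refine tendsto_nhds_unique hL ?_
  refine hR.congr fun D => ?_
  exact (partial_sum_identity h hπ k D).symm

end Place

end HarmonicMZV

theorem mainTheorem4 (F K : Type*) [Field F] [Fintype F] [Field K] [Algebra F K]
    [Algebra F⟮X⟯ K] [IsScalarTower F F⟮X⟯ K] [FunctionField F K]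
    (hconst : ∀ x : K, IsAlgebraic F x → x ∈ (algebraMap F K).range)
    (P : HarmonicMZV.Place F K) (hP : P.IsRational)
    (π : P.KInf) (hπ : P.IsUniformizer π) :
    -- all the objects are well defined: the sums are finite, the limits and series converge
    (∀ d : ℕ, (HarmonicMZV.Place.monic π d).Finite) ∧
    (∀ k : ℕ, Tendsto
      (fun d => algebraMap K P.KInf
        (HarmonicMZV.Place.multiSum π (HarmonicMZV.Place.expTuple F k) d))
      atTop (𝓝 (HarmonicMZV.Place.zeta π (HarmonicMZV.Place.expTuple F k)))) ∧
    (∀ k : ℕ, HasSum (HarmonicMZV.Place.ZTerm π k) (HarmonicMZV.Place.Z π k)) ∧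
    -- the functions are entire
    (∀ k : ℕ, HarmonicMZV.Place.IsEntire (HarmonicMZV.Place.Z π k)) ∧
    (∀ k : ℕ, HarmonicMZV.Place.IsEntire
      (HarmonicMZV.Tate.twist F P.baseRing P.CInf (HarmonicMZV.Place.Z π k))) ∧
    -- the harmonic product identity
    (∀ k : ℕ, 1 ≤ k →
      HarmonicMZV.Place.Z π 0 *
          HarmonicMZV.Tate.const F P.baseRing (algebraMap P.KInf P.CInf
            (HarmonicMZV.Place.zeta π (HarmonicMZV.Place.expTuple F k))) =
        HarmonicMZV.Place.Z π k +
          HarmonicMZV.Tate.twist F P.baseRing P.CInf (HarmonicMZV.Place.Z π (k - 1))) := by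
  have h : P.IsStandard := HarmonicMZV.Place.isStandard hconst hP
  refine ⟨HarmonicMZV.Place.finite_monic h hπ, fun k =>
    HarmonicMZV.Place.tendsto_multiSum h hπ fun s hs =>
      HarmonicMZV.Place.one_le_of_mem_expTuple F hs,
    fun k => (HarmonicMZV.Place.Z_spec h hπ k).2, fun k => (HarmonicMZV.Place.Z_spec h hπ k).1,
    fun k => (HarmonicMZV.Place.Z_spec h hπ k).1.twist h, fun k hk => ?_⟩
  obtain ⟨k, rfl⟩ := Nat.exists_eq_add_of_le' hk
  exact HarmonicMZV.Place.harmonic_product h hπ k
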